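/- Let $(M^n,g)$ be a compact smooth Riemannian manifold with smooth boundary $\partial M$, let $\iota:\partial M\to M$ be the inclusion, $\nu$ the inward unit normal, $d$, $\delta$ and $\Delta=d\delta+\delta d$ the exterior derivative, the codifferential and the Hodge--de Rham Laplacian, let $p\ge 0$ be a degree and $\ell\in\mathbb R$. For $p$-forms $\omega$ consider the boundary problems consisting of $\Delta^2\omega=0$ on $M$, $\nu\lrcorner\omega=0$, $\nu\lrcorner d\omega=0$ on $\partial M$, and the following further conditions on $\partial M$: - (BSN1) $\nu\lrcorner\Delta\omega+\ell\,\iota^*\delta\omega=0$ and $\nu\lrcorner\Delta d\omega+\ell\,\iota^*\omega=0$; - (BSN2) $\iota^*\delta\omega=0$ and $\nu\lrcorner\Delta d\omega+\ell\,\iota^*\omega=0$; - (BSN3) $\nu\lrcorner\Delta\omega=0$ and $\nu\lrcorner\Delta d\omega+\ell\,\iota^*\omega=0$ (for $p=0$ the conditions with values in $\Lambda^{-1}T^*\partial M=0$ are void). Then BSN1, BSN2 and BSN3 are elliptic in the sense of Shapiro--Lopatinskij. Here the principal symbol of an operator $A$ of order $k$ is $\sigma_A(\xi)=\frac1{k!}[\cdots[[A,f],f]\cdots,f]$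 ($k$ commutators) at $x$, for $f$ smooth with $d_xf=\xi$, and a boundary problem $A\omega=0$ on $M$, $B_j\omega=0$ on $\partial M$, with $A:\Omega^p(M)\to\Omega^p(M)$ and $B_j:\Omega^p(M)\to\Gamma(E_j)$, is elliptic in the sense of Shapiro--Lopatinskij if (a) $\sigma_A(\xi)$ is invertible for all $\xi\in T^*M\setminus\{0\}$, and (b) for all $x\in\partial M$ and $v\in T_x^*\partial M\setminus\{0\}$ the linear map $y\mapsto\big(\sigma_{B_j}(-iv+\partial_t\nu^\flat)y\,(0)\big)_j$ is an isomorphism from the space $\mathcal M^+_{A,v}$ of the solutions $y\in C^\infty(\mathbb R,\Lambda^pT_x^*M\otimes\mathbb C)$ of $\sigma_A(-iv+\partial_t\nu^\flat)y=0$ that are bounded on $[0,\infty)$ onto $\bigoplus_j (E_j)_x\otimes\mathbb C$; in (b) the symbols, which are homogeneous polynomials in the covector, are evaluated at $-iv+\partial_t\nu^\flat$ by substituting $s=-i$, $t=\partial_t$ in their values at $sv+t\nu^\flat$. -/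

import Mathlib

open scoped Manifold ContDiff

noncomputable section

namespace SteklovForms

/-! ### Forms in one Euclidean chart -/

/-- The model space `ℝⁿ`. For a manifold `M` modelled on the half-space `{y | 0 ≤ y 0}`, Mathlib's
`TangentSpace (𝓡∂ n) x` is by definition this space, a tangent vector at `x` being identified with
its coordinates in the preferred chart `extChartAt (𝓡∂ n) x`. -/
abbrev Model (n : ℕ) : Type := EuclideanSpace ℝ (Fin n)

/-- `Λᵖ(ℝⁿ)*`, hence also `Λᵖ Tₓ*M`. -/
abbrev Alt (n p : ℕ) : Type := Model n [⋀^Fin p]→L[ℝ] ℝ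

/-- A bilinear form on `ℝⁿ` (the metric tensor at a point), seen as the map `♭ : V → V*`. -/
abbrev Bilin (n : ℕ) : Type := Model n →L[ℝ] Model n →L[ℝ] ℝ

/-- The `i`-th coordinate vector of `ℝⁿ`. -/
def coordVec {n : ℕ} (i : Fin n) : Model n := EuclideanSpace.single i 1

/-- The `i`-th coordinate covector `dxⁱ` of `ℝⁿ`. -/
def coordCovec {n : ℕ} (i : Fin n) : Model n →L[ℝ] ℝ := EuclideanSpace.proj i

/-- The musical isomorphism `♯ : V* → V`, inverse of `♭ = G`. -/
def sharp {n : ℕ} (G : Bilin n) : (Model n →L[ℝ] ℝ) →L[ℝ] Model n :=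
  ContinuousLinearMap.inverse G

/-- The Riemannian volume density `√(det (G_{ij}))`. -/
def volDensity {n : ℕ} (G : Bilin n) : ℝ :=
  √ (Matrix.of fun i j : Fin n => G (coordVec i) (coordVec j)).det

/-- The exterior derivative of a `p`-form on `S ⊆ ℝⁿ`. -/
def localD {n p : ℕ} (S : Set (Model n)) (u : Model n → Alt n p) : Model n → Alt n (p + 1) :=
  extDerivWithin u S

/-- The codifferential (formal adjoint of `d`) of the metric `G` on `S ⊆ ℝⁿ`, by the classical
coordinate formula: the form `u` is turned into the multivector field `u^♯`, `(δu)^♯` is minus its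
divergence, `(δu)^{i₂…} = - |G|^{-1/2} ∑ⱼ ∂ⱼ (|G|^{1/2} u^{j i₂…})`, and all remaining indices are
lowered again. -/
def localCodiff {n p : ℕ} (S : Set (Model n)) (G : Model n → Bilin n)
    (u : Model n → Alt n (p + 1)) : Model n → Alt n p := fun y =>
  -((volDensity (G y))⁻¹ •
    (∑ j : Fin n,
      ((fderivWithin ℝ
          (fun z => volDensity (G z) • (u z).compContinuousLinearMap (sharp (G z))) S y
          (coordVec j)).curryLeft (coordCovec j))).compContinuousLinearMap (G y))

/-- The Hodge-de Rham Laplacian `Δ = dδ + δd` (on functions `δ = 0`, so `Δ = δd`). -/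
def localLaplacian {n : ℕ} (S : Set (Model n)) (G : Model n → Bilin n) :
    (p : ℕ) → (Model n → Alt n p) → Model n → Alt n p
  | 0, u => localCodiff S G (localD S u)
  | _ + 1, u => localD S (localCodiff S G u) + localCodiff S G (localD S u)

/-! ### Forms on a manifold with boundary -/

section Manifold

variable {n : ℕ} [NeZero n] {M : Type*} [TopologicalSpace M]
  [ChartedSpace (EuclideanHalfSpace n) M]

/-- The coordinate frame of the chart at `x`: the derivative at the coordinate point `y` of the
inverse of that chart, `ℝⁿ → T_z M`, `z` being the point with coordinates `y`. -/
def chartFrame (x : M) (y : Model n) : Model n →L[ℝ] Model n :=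
  mfderivWithin 𝓘(ℝ, Model n) (𝓡∂ n) (extChartAt (𝓡∂ n) x).symm (Set.range (𝓡∂ n)) y

/-- The expression of a `p`-form in the chart at `x` (its pullback by the inverse chart). -/
def chartForm {p : ℕ} (η : M → Alt n p) (x : M) (y : Model n) : Alt n p :=
  (η ((extChartAt (𝓡∂ n) x).symm y)).compContinuousLinearMap (chartFrame x y)

/-- `η ∈ Ωᵖ(M)`: the expression of the section `η` of `Λᵖ T*M` in every chart is smooth. -/
def IsSmoothForm {p : ℕ} (η : M → Alt n p) : Prop :=
  ∀ x : M, ContDiffOn ℝ ∞ (chartForm η x) (extChartAt (𝓡∂ n) x).target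

/-- The differential of a real function at `x`. -/
def differential (f : M → ℝ) (x : M) : Model n →L[ℝ] ℝ :=
  mfderiv (𝓡∂ n) 𝓘(ℝ, ℝ) f x

/-- The tangent space `Tₓ∂M` at a boundary point, as a subspace of `TₓM`. -/
def bdryTangent (n : ℕ) [NeZero n] : Submodule ℝ (Model n) :=
  LinearMap.ker (coordCovec (0 : Fin n)).toLinearMap

/-- `Λ^q Tₓ*∂M`. -/
abbrev BdryAlt (n q : ℕ) [NeZero n] : Type := bdryTangent n [⋀^Fin q]→L[ℝ] ℝ

/-- `ι*` at a boundary point: restriction to vectors tangent to the boundary. -/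
def restrict {q : ℕ} (η : Alt n q) : BdryAlt n q :=
  η.compContinuousLinearMap (bdryTangent n).subtypeL

/-- `ν ⌟ η`, as an alternating form on the tangent space of the boundary. -/
def contract {q : ℕ} (ν : Model n) (η : Alt n (q + 1)) : BdryAlt n q :=
  restrict (η.curryLeft ν)

variable [IsManifold (𝓡∂ n) ∞ M]

variable (n M) in
/-- Smooth Riemannian metrics on `M`. -/
abbrev Metric : Type _ :=
  Bundle.ContMDiffRiemannianMetric (𝓡∂ n) ∞ (Model n) (fun x : M => TangentSpace (𝓡∂ n) x)

/-- The metric at a point. -/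
def metricAt (g : Metric n M) (x : M) : Bilin n := g.inner x

/-- The expression of the metric in the chart at `x`. -/
def chartMetric (g : Metric n M) (x : M) (y : Model n) : Bilin n :=
  (metricAt g ((extChartAt (𝓡∂ n) x).symm y)).bilinearComp (chartFrame x y) (chartFrame x y)

/-- The operator on forms of `M` given by a coordinate expression `L` (depending on the coordinate
domain and on the metric): its value at `x` is computed in the chart at `x`. The operators below are
natural under changes of coordinates, so that the choice of chart does not matter for smooth
forms. -/
def inChart {p q : ℕ} (g : Metric n M)
    (L : Set (Model n) → (Model n → Bilin n) → (Model n → Alt n p) → Model n → Alt n q)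
    (η : M → Alt n p) (x : M) : Alt n q :=
  L (extChartAt (𝓡∂ n) x).target (chartMetric g x) (chartForm η x) (extChartAt (𝓡∂ n) x x)

/-- The exterior derivative `d`. -/
def extD {p : ℕ} (g : Metric n M) : (M → Alt n p) → M → Alt n (p + 1) :=
  inChart g fun S _ u => localD S u

/-- The codifferential `δ`. -/
def codiff {p : ℕ} (g : Metric n M) : (M → Alt n (p + 1)) → M → Alt n p :=
  inChart g fun S G u => localCodiff S G u

/-- The Hodge-de Rham Laplacian `Δ`. -/
def laplacian {p : ℕ} (g : Metric n M) : (M → Alt n p) → M → Alt n p :=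
  inChart g fun S G u => localLaplacian S G p u

/-- `Δd`. -/
def laplacianD {p : ℕ} (g : Metric n M) : (M → Alt n p) → M → Alt n (p + 1) :=
  inChart g fun S G u => localLaplacian S G (p + 1) (localD S u)

/-- The bi-Laplacian `Δ²`. -/
def biLaplacian {p : ℕ} (g : Metric n M) : (M → Alt n p) → M → Alt n p :=
  inChart g fun S G u => localLaplacian S G p (localLaplacian S G p u)

/-- The inward unit normal `ν` at a boundary point: the normalized gradient of the first coordinate,
which vanishes on the boundary and is positive inside. -/
def normal (g : Metric n M) (x : M) : Model n :=
  (√ (coordCovec 0 (sharp (metricAt g x) (coordCovec 0))))⁻¹ •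
    sharp (metricAt g x) (coordCovec 0)

end Manifold

/-! ### Boundary problems and their symbols -/

/-- The commutator `[A, f]` of an operator `A`, from functions on `M` (sections) to functions on
`X`, with the multiplication by `f : M → ℝ`. Here `π : X → M` is the identity of `M` or the inclusion
of the boundary. -/
def commutator {M X V W : Type*} [AddCommGroup V] [Module ℝ V] [AddCommGroup W] [Module ℝ W]
    (π : X → M) (f : M → ℝ) (A : (M → V) → X → W) : (M → V) → X → W :=
  fun η x => A (fun z => f z • η z) x - f (π x) • A η x

/-- `σ` is the principal symbol at `x` of the operator `A` of order `k` on `p`-forms: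
`σ(ξ) = (1/k!) [⋯[[A, f], f]⋯, f]` (`k` commutators) at `x`, for every smooth `f` with
`dₓf = ξ`. -/
def HasPrincipalSymbolAt {n p : ℕ} [NeZero n] {M X W : Type*} [TopologicalSpace M]
    [ChartedSpace (EuclideanHalfSpace n) M] [AddCommGroup W] [Module ℝ W]
    (π : X → M) (A : (M → Alt n p) → X → W) (k : ℕ) (x : X)
    (σ : (Model n →L[ℝ] ℝ) → Alt n p →ₗ[ℝ] W) : Prop :=
  ∀ f : M → ℝ, ContMDiff (𝓡∂ n) 𝓘(ℝ, ℝ) ∞ f → ∀ η : M → Alt n p, IsSmoothForm η →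
    ((k.factorial : ℝ)⁻¹ • ((commutator π f)^[k] A) η x) = σ (differential f (π x)) (η (π x))

section Symbols

variable {V W : Type*} [NormedAddCommGroup V] [NormedSpace ℝ V]
  [NormedAddCommGroup W] [NormedSpace ℝ W] {p q : ℕ}

/-- The complex-linear extension of a real linear map between spaces of alternating forms;
`Λᵖ V* ⊗ ℂ` is the space of complex-valued alternating forms. -/
def complexify (c : (V [⋀^Fin p]→L[ℝ] ℝ) →ₗ[ℝ] (W [⋀^Fin q]→L[ℝ] ℝ)) :
    (V [⋀^Fin p]→L[ℝ] ℂ) →ₗ[ℂ] (W [⋀^Fin q]→L[ℝ] ℂ) where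
  toFun y :=
    Complex.ofRealCLM.compContinuousAlternatingMap
        (c (Complex.reCLM.compContinuousAlternatingMap y)) +
      Complex.I • Complex.ofRealCLM.compContinuousAlternatingMap
        (c (Complex.imCLM.compContinuousAlternatingMap y))
  map_add' y z := by
    have h1 : Complex.reCLM.compContinuousAlternatingMap (y + z) =
        Complex.reCLM.compContinuousAlternatingMap y +
          Complex.reCLM.compContinuousAlternatingMap z := by ext; simp
    have h2 : Complex.imCLM.compContinuousAlternatingMap (y + z) =
        Complex.imCLM.compContinuousAlternatingMap y +
          Complex.imCLM.compContinuousAlternatingMap z := by ext; simp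
    rw [h1, h2, map_add, map_add]
    ext w
    simp
    ring
  map_smul' a y := by
    have h1 : Complex.reCLM.compContinuousAlternatingMap (a • y) =
        a.re • Complex.reCLM.compContinuousAlternatingMap y -
          a.im • Complex.imCLM.compContinuousAlternatingMap y := by ext; simp
    have h2 : Complex.imCLM.compContinuousAlternatingMap (a • y) =
        a.re • Complex.imCLM.compContinuousAlternatingMap y +
          a.im • Complex.reCLM.compContinuousAlternatingMap y := by ext; simp
    rw [h1, h2, map_add, map_sub, map_smul, map_smul, map_smul, map_smul]
    ext w
    apply Complex.ext <;> simp <;> ring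

/-- The symbol `σ`, homogeneous of degree `k` in the covector, has the expansion
`σ(s v + t μ) = ∑ⱼ s^(k-j) t^j cⱼ` on the plane spanned by `v` and `μ`. -/
def HasExpansion {X Y : Type*} [AddCommGroup X] [Module ℝ X] [AddCommGroup Y] [Module ℝ Y]
    (σ : (V →L[ℝ] ℝ) → X →ₗ[ℝ] Y) (k : ℕ) (v μ : V →L[ℝ] ℝ) (c : ℕ → X →ₗ[ℝ] Y) : Prop :=
  ∀ s t : ℝ, σ (s • v + t • μ) = ∑ j ∈ Finset.range (k + 1), (s ^ (k - j) * t ^ j) • c j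

/-- The differential operator `σ(-iv + ∂ₜ μ)` obtained from the expansion of `σ` by the
substitution `s = -i`, `t = ∂ₜ`, applied to a curve `y` of complex alternating forms. -/
def symbolOp (k : ℕ) (c : ℕ → (V [⋀^Fin p]→L[ℝ] ℝ) →ₗ[ℝ] (W [⋀^Fin q]→L[ℝ] ℝ))
    (y : ℝ → V [⋀^Fin p]→L[ℝ] ℂ) (t : ℝ) : W [⋀^Fin q]→L[ℝ] ℂ :=
  ∑ j ∈ Finset.range (k + 1), (-Complex.I) ^ (k - j) • complexify (c j) (iteratedDeriv j y t)

theorem symbolOp_add (k : ℕ) (c : ℕ → (V [⋀^Fin p]→L[ℝ] ℝ) →ₗ[ℝ] (W [⋀^Fin q]→L[ℝ] ℝ))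
    {y z : ℝ → V [⋀^Fin p]→L[ℝ] ℂ} (hy : ContDiff ℝ ∞ y) (hz : ContDiff ℝ ∞ z) (t : ℝ) :
    symbolOp k c (y + z) t = symbolOp k c y t + symbolOp k c z t := by
  simp only [symbolOp, ← Finset.sum_add_distrib]
  refine Finset.sum_congr rfl fun j _ => ?_
  rw [iteratedDeriv_add (hy.contDiffAt.of_le (by exact_mod_cast le_top))
    (hz.contDiffAt.of_le (by exact_mod_cast le_top)), map_add, smul_add]

theorem symbolOp_smul (k : ℕ) (c : ℕ → (V [⋀^Fin p]→L[ℝ] ℝ) →ₗ[ℝ] (W [⋀^Fin q]→L[ℝ] ℝ))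
    (a : ℂ) (y : ℝ → V [⋀^Fin p]→L[ℝ] ℂ) (t : ℝ) :
    symbolOp k c (a • y) t = a • symbolOp k c y t := by
  simp only [symbolOp, Finset.smul_sum]
  refine Finset.sum_congr rfl fun j _ => ?_
  rw [iteratedDeriv_const_smul_field, map_smul, smul_comm]

/-- The space `M⁺` of solutions `y` of the equation `σ(-iv + ∂ₜ μ) y = 0` which are bounded on
`ℝ₊`. -/
def boundedSolutions (k : ℕ) (c : ℕ → (V [⋀^Fin p]→L[ℝ] ℝ) →ₗ[ℝ] (W [⋀^Fin q]→L[ℝ] ℝ)) :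
    Submodule ℂ (ℝ → V [⋀^Fin p]→L[ℝ] ℂ) where
  carrier := {y | ContDiff ℝ ∞ y ∧ (∀ t, symbolOp k c y t = 0) ∧ ∃ C : ℝ, ∀ t, 0 ≤ t → ‖y t‖ ≤ C}
  zero_mem' := by
    refine ⟨contDiff_const, fun t => ?_, 0, fun t _ => by simp⟩
    have h := symbolOp_smul k c 0 0 t
    have h0 : (0 : ℂ) • (0 : ℝ → V [⋀^Fin p]→L[ℝ] ℂ) = 0 := by ext; simp
    rw [h0] at h
    rw [h]
    ext w
    simp
  add_mem' := by
    rintro y z ⟨hy, hy', C, hC⟩ ⟨hz, hz', D, hD⟩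
    refine ⟨hy.add hz, fun t => ?_, C + D, fun t ht => ?_⟩
    · rw [symbolOp_add k c hy hz, hy', hz', add_zero]
    · exact (norm_add_le _ _).trans (add_le_add (hC t ht) (hD t ht))
  smul_mem' := by
    rintro a y ⟨hy, hy', C, hC⟩
    refine ⟨hy.const_smul a, fun t => ?_, ‖a‖ * C, fun t ht => ?_⟩
    · rw [symbolOp_smul, hy']
      ext w
      simp
    · rw [Pi.smul_apply, norm_smul]
      exact mul_le_mul_of_nonneg_left (hC t ht) (norm_nonneg a)

/-- The map `Φ : y ↦ (σ_{B₁}(-iv + ∂ₜ μ) y, …, σ_{Bₘ}(-iv + ∂ₜ μ) y)(0)` on `M⁺`, where `b j` is the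
expansion of the symbol of the boundary operator `Bⱼ` of order `r j`. -/
def boundarySymbolMap {U : Type*} [NormedAddCommGroup U] [NormedSpace ℝ U] {m : ℕ}
    (k : ℕ) (c : ℕ → (V [⋀^Fin p]→L[ℝ] ℝ) →ₗ[ℝ] (W [⋀^Fin q]→L[ℝ] ℝ))
    (r d : Fin m → ℕ)
    (b : (j : Fin m) → ℕ → (V [⋀^Fin p]→L[ℝ] ℝ) →ₗ[ℝ] (U [⋀^Fin (d j)]→L[ℝ] ℝ)) :
    boundedSolutions k c →ₗ[ℂ] ((j : Fin m) → U [⋀^Fin (d j)]→L[ℝ] ℂ) where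
  toFun y j := symbolOp (r j) (b j) y.1 0
  map_add' y z := by
    funext j
    exact symbolOp_add (r j) (b j) y.2.1 z.2.1 0
  map_smul' a y := by
    funext j
    exact symbolOp_smul (r j) (b j) a y.1 0

end Symbols

/-- A boundary operator `B : Ωᵖ(M) → Γ(Λ^deg T*∂M)`, with its order. -/
structure BoundaryOperator (n : ℕ) [NeZero n] (M : Type*) [TopologicalSpace M]
    [ChartedSpace (EuclideanHalfSpace n) M] (p : ℕ) where
  deg : ℕ
  order : ℕ
  toFun : (M → Alt n p) → (𝓡∂ n).boundary M → BdryAlt n deg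

/-- A boundary problem `A η = 0` on `M`, `B₁ η = 0, …, Bₘ η = 0` on `∂M`, for `p`-forms. -/
structure BoundaryProblem (n : ℕ) [NeZero n] (M : Type*) [TopologicalSpace M]
    [ChartedSpace (EuclideanHalfSpace n) M] (p : ℕ) where
  order : ℕ
  interior : (M → Alt n p) → M → Alt n p
  numBdry : ℕ
  bdry : Fin numBdry → BoundaryOperator n M p

section Problems

variable {n : ℕ} [NeZero n] {M : Type*} [TopologicalSpace M]
  [ChartedSpace (EuclideanHalfSpace n) M] [IsManifold (𝓡∂ n) ∞ M]

/-- Ellipticity in the sense of Shapiro-Lopatinskij: the operators `A`, `Bⱼ` have principal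
symbols `σA`, `σB j`, the symbol of `A` is invertible at all nonzero covectors, and for every
`v ∈ Tₓ*∂M \ {0}` (a covector of `M` vanishing on `ν`) the map `Φ : M⁺ → ⨁ⱼ Eⱼ ⊗ ℂ` is an
isomorphism. -/
def BoundaryProblem.IsElliptic {p : ℕ} (P : BoundaryProblem n M p) (g : Metric n M) : Prop :=
  ∃ (σA : M → (Model n →L[ℝ] ℝ) → Alt n p →ₗ[ℝ] Alt n p)
    (σB : (j : Fin P.numBdry) → (𝓡∂ n).boundary M → (Model n →L[ℝ] ℝ) →
      Alt n p →ₗ[ℝ] BdryAlt n (P.bdry j).deg),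
    (∀ x, HasPrincipalSymbolAt id P.interior P.order x (σA x)) ∧
    (∀ j x, HasPrincipalSymbolAt Subtype.val (P.bdry j).toFun (P.bdry j).order x (σB j x)) ∧
    (∀ x, ∀ ξ : Model n →L[ℝ] ℝ, ξ ≠ 0 → Function.Bijective (σA x ξ)) ∧
    ∀ (x : (𝓡∂ n).boundary M) (v : Model n →L[ℝ] ℝ), v (normal g x.1) = 0 → v ≠ 0 →
      ∃ (c : ℕ → Alt n p →ₗ[ℝ] Alt n p)
        (b : (j : Fin P.numBdry) → ℕ → Alt n p →ₗ[ℝ] BdryAlt n (P.bdry j).deg),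
        HasExpansion (σA x.1) P.order v (metricAt g x.1 (normal g x.1)) c ∧
        (∀ j, HasExpansion (σB j x) (P.bdry j).order v (metricAt g x.1 (normal g x.1)) (b j)) ∧
        Function.Bijective (boundarySymbolMap P.order c
          (fun j => (P.bdry j).order) (fun j => (P.bdry j).deg) b)

/-- `η ↦ ν ⌟ η`. -/
def opNormal {p : ℕ} (g : Metric n M) : BoundaryOperator n M (p + 1) :=
  ⟨p, 0, fun η x => contract (normal g x.1) (η x.1)⟩

/-- `η ↦ ν ⌟ dη`. -/
def opNormalD {p : ℕ} (g : Metric n M) : BoundaryOperator n M p :=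
  ⟨p, 1, fun η x => contract (normal g x.1) (extD g η x.1)⟩

/-- `η ↦ ν ⌟ Δdη + ℓ ι*η`. -/
def opNormalLapD {p : ℕ} (g : Metric n M) (l : ℝ) : BoundaryOperator n M p :=
  ⟨p, 3, fun η x => contract (normal g x.1) (laplacianD g η x.1) + l • restrict (η x.1)⟩

/-- `η ↦ ν ⌟ Δη + ℓ ι*δη`; for `ℓ = 0` this is `η ↦ ν ⌟ Δη`. -/
def opNormalLap {p : ℕ} (g : Metric n M) (l : ℝ) : BoundaryOperator n M (p + 1) :=
  ⟨p, 2, fun η x =>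
    contract (normal g x.1) (laplacian g η x.1) + l • restrict (codiff g η x.1)⟩

/-- `η ↦ ι*δη`. -/
def opCodiff {p : ℕ} (g : Metric n M) : BoundaryOperator n M (p + 1) :=
  ⟨p, 1, fun η x => restrict (codiff g η x.1)⟩

/-- The problem BSN1: `Δ²η = 0`, `ν⌟η = 0`, `ν⌟dη = 0`, `ν⌟Δη + ℓ ι*δη = 0`, `ν⌟Δdη + ℓ ι*η = 0`.
For functions the conditions with values in `Λ⁻¹ T*∂M = 0` are void. -/
def BSN1 (g : Metric n M) (l : ℝ) : (p : ℕ) → BoundaryProblem n M p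
  | 0 => ⟨4, biLaplacian g, 2, ![opNormalD g, opNormalLapD g l]⟩
  | _ + 1 => ⟨4, biLaplacian g, 4, ![opNormal g, opNormalD g, opNormalLap g l, opNormalLapD g l]⟩

/-- The problem BSN2: `Δ²η = 0`, `ν⌟η = 0`, `ν⌟dη = 0`, `ι*δη = 0`, `ν⌟Δdη + ℓ ι*η = 0`. -/
def BSN2 (g : Metric n M) (l : ℝ) : (p : ℕ) → BoundaryProblem n M p
  | 0 => ⟨4, biLaplacian g, 2, ![opNormalD g, opNormalLapD g l]⟩
  | _ + 1 => ⟨4, biLaplacian g, 4, ![opNormal g, opNormalD g, opCodiff g, opNormalLapD g l]⟩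

/-- The problem BSN3: `Δ²η = 0`, `ν⌟η = 0`, `ν⌟dη = 0`, `ν⌟Δη = 0`, `ν⌟Δdη + ℓ ι*η = 0`. -/
def BSN3 (g : Metric n M) (l : ℝ) : (p : ℕ) → BoundaryProblem n M p
  | 0 => ⟨4, biLaplacian g, 2, ![opNormalD g, opNormalLapD g l]⟩
  | _ + 1 => ⟨4, biLaplacian g, 4, ![opNormal g, opNormalD g, opNormalLap g 0, opNormalLapD g l]⟩

end Problems

end SteklovForms

end

noncomputable section

namespace SteklovForms

open Set Filter Topology

/-! ### Exterior and interior multiplication -/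

section Exterior

variable {V : Type*} [NormedAddCommGroup V] [NormedSpace ℝ V] {p : ℕ}

/-- Exterior multiplication `u ↦ ξ ∧ u` by a covector. -/
def wedge (ξ : V →L[ℝ] ℝ) : (V [⋀^Fin p]→L[ℝ] ℝ) →ₗ[ℝ] (V [⋀^Fin (p + 1)]→L[ℝ] ℝ) where
  toFun u := .alternatizeUncurryFin (ξ.smulRight u)
  map_add' u v := by
    rw [← ContinuousAlternatingMap.alternatizeUncurryFin_add]; congr 1; ext; simp
  map_smul' c u := by
    rw [RingHom.id_apply, ← ContinuousAlternatingMap.alternatizeUncurryFin_smul]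
    congr 1; ext; simp [mul_left_comm]

/-- Interior multiplication `u ↦ a ⌟ u` by a vector. -/
def interiorMul (a : V) : (V [⋀^Fin (p + 1)]→L[ℝ] ℝ) →ₗ[ℝ] (V [⋀^Fin p]→L[ℝ] ℝ) where
  toFun u := u.curryLeft a
  map_add' _ _ := rfl
  map_smul' _ _ := rfl

theorem wedge_apply (ξ : V →L[ℝ] ℝ) (u : V [⋀^Fin p]→L[ℝ] ℝ) (w : Fin (p + 1) → V) :
    wedge ξ u w = ∑ i : Fin (p + 1), (-1 : ℝ) ^ (i : ℕ) * (ξ (w i) * u (i.removeNth w)) := by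
  have h : wedge ξ u w = _ :=
    ContinuousAlternatingMap.alternatizeUncurryFin_apply (ξ.smulRight u) w
  rw [h]
  simp

theorem interiorMul_apply (a : V) (u : V [⋀^Fin (p + 1)]→L[ℝ] ℝ) (w : Fin p → V) :
    interiorMul a u w = u (Fin.cons a w) := rfl

theorem wedge_smul_left (c : ℝ) (ξ : V →L[ℝ] ℝ) :
    wedge (p := p) (c • ξ) = c • wedge ξ := by
  ext u w
  simp [wedge_apply, Finset.mul_sum, mul_left_comm, mul_assoc]

theorem wedge_add_left (ξ ζ : V →L[ℝ] ℝ) :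
    wedge (p := p) (ξ + ζ) = wedge ξ + wedge ζ := by
  ext u w
  simp [wedge_apply, add_mul, mul_add, Finset.sum_add_distrib]

theorem interiorMul_smul_left (c : ℝ) (a : V) :
    interiorMul (p := p) (c • a) = c • interiorMul a := by
  ext u w
  exact congrArg (· w) (u.curryLeft.map_smul c a)

theorem interiorMul_add_left (a b : V) :
    interiorMul (p := p) (a + b) = interiorMul a + interiorMul b := by
  ext u w
  exact congrArg (· w) (u.curryLeft.map_add a b)

theorem interiorMul_interiorMul_self (a : V) (u : V [⋀^Fin (p + 2)]→L[ℝ] ℝ) :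
    interiorMul a (interiorMul a u) = 0 :=
  ContinuousAlternatingMap.curryLeft_same u a

theorem interiorMul_wedge_zero (a : V) (ξ : V →L[ℝ] ℝ) (u : V [⋀^Fin 0]→L[ℝ] ℝ) :
    interiorMul a (wedge ξ u) = ξ a • u := by
  ext w
  rw [interiorMul_apply, wedge_apply]
  simp

theorem interiorMul_wedge (a : V) (ξ : V →L[ℝ] ℝ) (u : V [⋀^Fin (p + 1)]→L[ℝ] ℝ) :
    interiorMul a (wedge ξ u) = ξ a • u - wedge ξ (interiorMul a u) := by
  ext w
  change _ = ξ a * u w - wedge ξ (interiorMul a u) w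
  rw [interiorMul_apply, wedge_apply, Fin.sum_univ_succ, wedge_apply, sub_eq_add_neg,
    ← Finset.sum_neg_distrib]
  congr 1
  · simp
  · refine Finset.sum_congr rfl fun i _ => ?_
    have : i.succ.removeNth (Fin.cons a w : Fin (p + 2) → V) =
        (Fin.cons a (i.removeNth w) : Fin (p + 1) → V) := by
      funext j
      refine Fin.cases ?_ (fun j => ?_) j
      · simp [Fin.removeNth]
      · simp [Fin.removeNth]
    rw [this, interiorMul_apply]
    simp [pow_succ]

end Exterior

/-! ### Smoothness of families of alternating forms -/

section Smoothness

variable {p : ℕ} {D : Type*} [NormedAddCommGroup D] [NormedSpace ℝ D] {S : Set D}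
  {E F : Type*} [NormedAddCommGroup E] [NormedSpace ℝ E] [FiniteDimensional ℝ E]
  [NormedAddCommGroup F] [NormedSpace ℝ F] [FiniteDimensional ℝ F]

theorem contDiffOn_alt_iff {f : D → E [⋀^Fin p]→L[ℝ] ℝ} :
    ContDiffOn ℝ ∞ f S ↔ ∀ v, ContDiffOn ℝ ∞ (fun y => f y v) S := by
  refine ⟨fun h v => ?_, fun h => ?_⟩
  · exact (ContinuousAlternatingMap.apply ℝ E ℝ v).contDiff.comp_contDiffOn h
  let e := Module.finBasis ℝ E
  let Φ : (E [⋀^Fin p]→L[ℝ] ℝ) →ₗ[ℝ] ((Fin p → Fin (Module.finrank ℝ E)) → ℝ) :=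
    { toFun := fun u r => u fun i => e (r i)
      map_add' := fun _ _ => rfl
      map_smul' := fun _ _ => rfl }
  have hΦ : LinearMap.ker Φ = ⊥ := by
    refine LinearMap.ker_eq_bot'.2 fun u hu => ?_
    have : u.toMultilinearMap = 0 :=
      Module.Basis.ext_multilinear (fun _ => e) fun r => congrFun hu r
    ext v
    exact DFunLike.congr_fun this v
  obtain ⟨Ψ, hΨ⟩ := Φ.exists_leftInverse_of_injective hΦ
  have h1 : ContDiffOn ℝ ∞ (fun y => Φ (f y)) S := contDiffOn_pi.2 fun r => h _
  exact (Ψ.toContinuousLinearMap.contDiff.comp_contDiffOn h1).congr fun y _ =>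
    (LinearMap.congr_fun hΨ (f y)).symm

theorem alt_apply_eq_sum {ι : Type*} [Fintype ι] (e : Module.Basis ι ℝ E)
    (u : E [⋀^Fin p]→L[ℝ] ℝ) (w : Fin p → E) :
    u w = ∑ r : Fin p → ι, (∏ i, e.coord (r i) (w i)) * u fun i => e (r i) := by
  conv_lhs => rw [show w = fun i => ∑ j, e.coord j (w i) • e j from
    funext fun i => (e.sum_repr _).symm]
  have h := u.toMultilinearMap.map_sum fun i (j : ι) => e.coord j (w i) • e j
  refine h.trans (Finset.sum_congr rfl fun r _ => ?_)
  exact u.toMultilinearMap.map_smul_univ (fun i => e.coord (r i) (w i)) _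

theorem contDiffOn_alt_apply {u : D → E [⋀^Fin p]→L[ℝ] ℝ} {w : D → Fin p → E}
    (hu : ContDiffOn ℝ ∞ u S) (hw : ∀ i, ContDiffOn ℝ ∞ (fun y => w y i) S) :
    ContDiffOn ℝ ∞ (fun y => u y (w y)) S := by
  let e := Module.finBasis ℝ E
  simp_rw [fun y => alt_apply_eq_sum e (u y) (w y)]
  refine ContDiffOn.sum fun r _ => ContDiffOn.mul (contDiffOn_prod fun i _ => ?_) ?_
  · exact (e.coord (r i)).toContinuousLinearMap.contDiff.comp_contDiffOn (hw i)
  · exact contDiffOn_alt_iff.1 hu _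

theorem contDiffOn_compContinuousLinearMap {u : D → E [⋀^Fin p]→L[ℝ] ℝ} {A : D → F →L[ℝ] E}
    (hu : ContDiffOn ℝ ∞ u S) (hA : ContDiffOn ℝ ∞ A S) :
    ContDiffOn ℝ ∞ (fun y => (u y).compContinuousLinearMap (A y)) S :=
  contDiffOn_alt_iff.2 fun w => contDiffOn_alt_apply (w := fun y i => A y (w i)) hu fun _ =>
    hA.clm_apply contDiffOn_const

theorem sum_coordCovec_smul_coordVec {n : ℕ} (a : Model n) :
    ∑ i, coordCovec i a • coordVec i = a := by
  ext j
  simp [coordCovec, coordVec, Pi.single_apply]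

end Smoothness

/-! ### Differential operators on a coordinate domain and their principal symbols -/

section LocalOperators

variable {n : ℕ} {S : Set (Model n)}
  {X Y Z : Type*} [NormedAddCommGroup X] [NormedSpace ℝ X] [NormedAddCommGroup Y] [NormedSpace ℝ Y]
  [NormedAddCommGroup Z] [NormedSpace ℝ Z]

/-- `L` is a linear operator on the smooth functions on `S`, local on `S`, and behaves under
multiplication by powers of a function `h` at the zeros of `h` like a differential operator of
order `k` with principal symbol `σ`. -/
structure IsDiffOp (S : Set (Model n)) (k : ℕ) (L : (Model n → X) → Model n → Y)
    (σ : Model n → (Model n →L[ℝ] ℝ) → X →ₗ[ℝ] Y) : Prop where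
  smooth : ∀ u, ContDiffOn ℝ ∞ u S → ContDiffOn ℝ ∞ (L u) S
  congr : ∀ u v, EqOn u v S → EqOn (L u) (L v) S
  map_sub_smul : ∀ (c : ℝ) (u v), ContDiffOn ℝ ∞ u S → ContDiffOn ℝ ∞ v S →
    EqOn (L (u - c • v)) (L u - c • L v) S
  symbol : ∀ (h : Model n → ℝ) (u), ContDiffOn ℝ ∞ h S → ContDiffOn ℝ ∞ u S → ∀ m : ℕ,
    ∃ w, ContDiffOn ℝ ∞ w S ∧
      EqOn (L fun y => h y ^ (m + k) • u y) (fun y => h y ^ m • w y) S ∧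
      ∀ y ∈ S, h y = 0 → w y =
        (((m + k).factorial : ℝ) / (m.factorial : ℝ)) • σ y (fderivWithin ℝ h S y) (u y)

theorem IsDiffOp.comp {k l : ℕ} {K : (Model n → Y) → Model n → Z} {L : (Model n → X) → Model n → Y}
    {τ : Model n → (Model n →L[ℝ] ℝ) → Y →ₗ[ℝ] Z} {σ : Model n → (Model n →L[ℝ] ℝ) → X →ₗ[ℝ] Y}
    (hK : IsDiffOp S k K τ) (hL : IsDiffOp S l L σ) :
    IsDiffOp S (k + l) (fun u => K (L u)) (fun y ξ => τ y ξ ∘ₗ σ y ξ) where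
  smooth u hu := hK.smooth _ (hL.smooth _ hu)
  congr u v h := hK.congr _ _ (hL.congr _ _ h)
  map_sub_smul c u v hu hv := (hK.congr _ _ (hL.map_sub_smul c u v hu hv)).trans
    (hK.map_sub_smul c _ _ (hL.smooth _ hu) (hL.smooth _ hv))
  symbol h u hh hu m := by
    obtain ⟨w, hw, hLw, hw0⟩ := hL.symbol h u hh hu (m + k)
    obtain ⟨z, hz, hKz, hz0⟩ := hK.symbol h w hh hw m
    rw [add_assoc] at hLw hw0
    refine ⟨z, hz, (hK.congr _ _ hLw).trans hKz, fun y hy hy0 => ?_⟩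
    rw [hz0 y hy hy0, hw0 y hy hy0, map_smul, smul_smul, LinearMap.comp_apply]
    congr 1
    have := Nat.factorial_ne_zero m
    have := Nat.factorial_ne_zero (m + k)
    field_simp

theorem IsDiffOp.add {k : ℕ} {K L : (Model n → X) → Model n → Y}
    {τ σ : Model n → (Model n →L[ℝ] ℝ) → X →ₗ[ℝ] Y}
    (hK : IsDiffOp S k K τ) (hL : IsDiffOp S k L σ) :
    IsDiffOp S k (fun u => K u + L u) (fun y ξ => τ y ξ + σ y ξ) where
  smooth u hu := (hK.smooth _ hu).add (hL.smooth _ hu)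
  congr u v h y hy := by simp [hK.congr u v h hy, hL.congr u v h hy]
  map_sub_smul c u v hu hv y hy := by
    have h1 := hK.map_sub_smul c u v hu hv hy
    have h2 := hL.map_sub_smul c u v hu hv hy
    simp only [Pi.add_apply, Pi.sub_apply, Pi.smul_apply] at h1 h2 ⊢
    rw [h1, h2, smul_add]
    abel
  symbol h u hh hu m := by
    obtain ⟨w, hw, hLw, hw0⟩ := hL.symbol h u hh hu m
    obtain ⟨z, hz, hKz, hz0⟩ := hK.symbol h u hh hu m
    refine ⟨z + w, hz.add hw, fun y hy => ?_, fun y hy hy0 => ?_⟩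
    · simp [hLw hy, hKz hy]
    · simp [hz0 y hy hy0, hw0 y hy hy0]

theorem IsDiffOp.congr_symbol {k : ℕ} {L : (Model n → X) → Model n → Y}
    {σ τ : Model n → (Model n →L[ℝ] ℝ) → X →ₗ[ℝ] Y} (hL : IsDiffOp S k L σ)
    (h : ∀ y ∈ S, ∀ ξ, σ y ξ = τ y ξ) : IsDiffOp S k L τ :=
  { hL with
    symbol := fun f u hf hu m => by
      obtain ⟨w, hw, hLw, hw0⟩ := hL.symbol f u hf hu m
      exact ⟨w, hw, hLw, fun y hy hy0 => by rw [hw0 y hy hy0, h y hy]⟩ }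

theorem IsDiffOp.of_leibniz {L : (Model n → X) → Model n → Y}
    {σ : Model n → (Model n →L[ℝ] ℝ) → X →ₗ[ℝ] Y} (hS : UniqueDiffOn ℝ S)
    (smooth : ∀ u, ContDiffOn ℝ ∞ u S → ContDiffOn ℝ ∞ (L u) S)
    (congr : ∀ u v, EqOn u v S → EqOn (L u) (L v) S)
    (map_sub_smul : ∀ (c : ℝ) (u v), ContDiffOn ℝ ∞ u S → ContDiffOn ℝ ∞ v S →
      EqOn (L (u - c • v)) (L u - c • L v) S)
    (hσ : ∀ y ∈ S, ∀ (c : ℝ) ξ, σ y (c • ξ) = c • σ y ξ)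
    (leibniz : ∀ (h : Model n → ℝ) (u), ContDiffOn ℝ ∞ h S → ContDiffOn ℝ ∞ u S → ∀ y ∈ S,
      L (fun y => h y • u y) y = h y • L u y + σ y (fderivWithin ℝ h S y) (u y)) :
    IsDiffOp S 1 L σ where
  smooth := smooth
  congr := congr
  map_sub_smul := map_sub_smul
  symbol h u hh hu m := by
    refine ⟨fun y => h y • L u y + (m + 1 : ℝ) • (L (fun y => h y • u y) y - h y • L u y),
      ?_, fun y hy => ?_, fun y hy hy0 => ?_⟩
    · exact (hh.smul (smooth u hu)).add
        (((smooth _ (hh.smul hu)).sub (hh.smul (smooth u hu))).const_smul _)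
    · have hd : DifferentiableWithinAt ℝ h S y := hh.differentiableOn (by simp) y hy
      rw [leibniz (fun y => h y ^ (m + 1)) u (hh.pow _) hu y hy,
        fderivWithin_fun_pow (hS y hy) _ hd, hσ y hy]
      simp only [leibniz h u hh hu y hy, add_tsub_cancel_right, add_sub_cancel_left, smul_add, smul_smul,
        LinearMap.smul_apply, pow_succ, nsmul_eq_mul]
      push_cast
      rw [mul_comm (h y ^ m) ((m : ℝ) + 1)]
    · simp only [leibniz h u hh hu y hy, hy0, zero_smul, zero_add, sub_zero]
      congr 1
      have := Nat.factorial_ne_zero m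
      rw [Nat.factorial_succ]
      push_cast
      field_simp

end LocalOperators

/-! ### The exterior derivative and the codifferential on a coordinate domain -/

/-- `G` is a smooth Riemannian metric on the coordinate domain `S`. -/
structure IsMetricOn {n : ℕ} (S : Set (Model n)) (G : Model n → Bilin n) : Prop where
  smooth : ContDiffOn ℝ ∞ G S
  symm : ∀ y ∈ S, ∀ a b, G y a b = G y b a
  pos : ∀ y ∈ S, ∀ a, a ≠ 0 → 0 < G y a a

section Metric

variable {n p : ℕ} {S : Set (Model n)} {G : Model n → Bilin n}

theorem isInvertible_of_pos {G : Bilin n} (pos : ∀ a, a ≠ 0 → 0 < G a a) : G.IsInvertible := by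
  have hinj : Function.Injective (G : Model n →ₗ[ℝ] Model n →L[ℝ] ℝ) := by
    refine (injective_iff_map_eq_zero _).2 fun a ha => ?_
    by_contra h0
    have := pos a h0
    rw [show G a = 0 from ha] at this
    simp at this
  have hdim : Module.finrank ℝ (Model n) = Module.finrank ℝ (Model n →L[ℝ] ℝ) := by
    rw [← (LinearMap.toContinuousLinearMap (𝕜 := ℝ) (E := Model n) (F' := ℝ)).finrank_eq]
    exact Subspace.dual_finrank_eq.symm
  exact ⟨(LinearMap.linearEquivOfInjective _ hinj hdim).toContinuousLinearEquiv, by ext; rfl⟩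

theorem sharp_flat {G : Bilin n} (pos : ∀ a, a ≠ 0 → 0 < G a a) (a : Model n) :
    sharp G (G a) = a := by
  obtain ⟨e, rfl⟩ := isInvertible_of_pos pos
  simp [sharp]

theorem flat_sharp {G : Bilin n} (pos : ∀ a, a ≠ 0 → 0 < G a a) (ξ : Model n →L[ℝ] ℝ) :
    G (sharp G ξ) = ξ := by
  obtain ⟨e, rfl⟩ := isInvertible_of_pos pos
  simp [sharp]

theorem gram_det_pos {G : Bilin n} (symm : ∀ a b, G a b = G b a)
    (pos : ∀ a, a ≠ 0 → 0 < G a a) :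
    0 < (Matrix.of fun i j : Fin n => G (coordVec i) (coordVec j)).det := by
  refine Matrix.PosDef.det_pos (Matrix.PosDef.of_dotProduct_mulVec_pos ?_ fun x hx => ?_)
  · ext i j
    simpa using symm _ _
  · have h : star x ⬝ᵥ (Matrix.of fun i j : Fin n => G (coordVec i) (coordVec j)).mulVec x =
        G (WithLp.toLp 2 x) (WithLp.toLp 2 x) := by
      have hs : WithLp.toLp 2 x = ∑ i, x i • coordVec i :=
        (sum_coordCovec_smul_coordVec (WithLp.toLp 2 x)).symm
      rw [hs]
      simp only [dotProduct, Matrix.mulVec, map_sum, Finset.mul_sum, map_smul,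
        sum_apply, smul_apply, Matrix.of_apply,
        Pi.star_apply, star_trivial, smul_eq_mul]
      refine Finset.sum_congr rfl fun i _ => Finset.sum_congr rfl fun j _ => ?_
      rw [symm]
      ring
    rw [h]
    exact pos _ (by simpa using hx)

theorem volDensity_pos {G : Bilin n} (symm : ∀ a b, G a b = G b a)
    (pos : ∀ a, a ≠ 0 → 0 < G a a) : 0 < volDensity G :=
  Real.sqrt_pos.2 (gram_det_pos symm pos)

theorem IsMetricOn.contDiffOn_sharp (hG : IsMetricOn S G) :
    ContDiffOn ℝ ∞ (fun y => sharp (G y)) S := fun y hy =>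
  ((isInvertible_of_pos (hG.pos y hy)).contDiffAt_map_inverse).comp_contDiffWithinAt y
    (hG.smooth y hy)

theorem IsMetricOn.contDiffOn_volDensity (hG : IsMetricOn S G) :
    ContDiffOn ℝ ∞ (fun y => volDensity (G y)) S := by
  refine ContDiffOn.sqrt ?_ fun y hy => (gram_det_pos (hG.symm y hy) (hG.pos y hy)).ne'
  simp only [Matrix.det_apply]
  refine ContDiffOn.sum fun σ _ => ContDiffOn.const_smul _ (contDiffOn_prod fun i _ => ?_)
  exact (hG.smooth.clm_apply contDiffOn_const).clm_apply contDiffOn_const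

theorem isDiffOp_localD (hS : UniqueDiffOn ℝ S) :
    IsDiffOp S 1 (localD (p := p) S) (fun _ ξ => wedge ξ) := by
  refine IsDiffOp.of_leibniz hS (fun u hu => ?_) (fun u v h y hy => ?_)
    (fun c u v hu hv y hy => ?_) (fun y _ c ξ => wedge_smul_left c ξ) fun h u hh hu y hy => ?_
  · exact (ContinuousAlternatingMap.alternatizeUncurryFinCLM ℝ (Model n) ℝ).contDiff.comp_contDiffOn
      (hu.fderivWithin hS (m := ∞) le_rfl)
  · exact extDerivWithin_congr' h hy
  · have hud := hu.differentiableOn (by simp) y hy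
    have hvd := hv.differentiableOn (by simp) y hy
    have h1 := fderivWithin_sub (hS y hy) hud (hvd.const_smul c)
    have h2 := fderivWithin_const_smul_field (𝕜 := ℝ) (R := ℝ) (f := v) c (hS y hy)
    change ContinuousAlternatingMap.alternatizeUncurryFinCLM ℝ (Model n) ℝ _ = 
      ContinuousAlternatingMap.alternatizeUncurryFinCLM ℝ (Model n) ℝ _ - 
        c • ContinuousAlternatingMap.alternatizeUncurryFinCLM ℝ (Model n) ℝ _
    rw [h1, h2, map_sub, map_smul]
  · have hud := hu.differentiableOn (by simp) y hy
    have hhd := hh.differentiableOn (by simp) y hy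
    change ContinuousAlternatingMap.alternatizeUncurryFinCLM ℝ (Model n) ℝ _ = 
      h y • ContinuousAlternatingMap.alternatizeUncurryFinCLM ℝ (Model n) ℝ _ +
        ContinuousAlternatingMap.alternatizeUncurryFinCLM ℝ (Model n) ℝ _
    rw [fderivWithin_fun_smul (hS y hy) hhd hud, map_add, map_smul]

section Divergence

variable {W : Type*} [NormedAddCommGroup W] [NormedSpace ℝ W]

/-- The form `-ρ⁻¹ ∑ⱼ θⱼ ⌟ A(eⱼ)` on `W`, pulled back by `B`. -/
def divergenceForm (ρ : ℝ) (B : Model n →L[ℝ] W) (θ : Fin n → W) :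
    (Model n →L[ℝ] (W [⋀^Fin (p + 1)]→L[ℝ] ℝ)) →ₗ[ℝ] Alt n p where
  toFun A := -(ρ⁻¹ • (∑ j : Fin n, (A (coordVec j)).curryLeft (θ j)).compContinuousLinearMap B)
  map_add' A B := by
    ext w
    simp [Finset.sum_add_distrib, mul_add]
    ring
  map_smul' c A := by
    ext w
    simp [← Finset.mul_sum]
    ring

/-- The density `ρ u` of a form, pulled back by `s`. -/
def densityForm (ρ : ℝ) (s : W →L[ℝ] Model n) : Alt n p →ₗ[ℝ] (W [⋀^Fin p]→L[ℝ] ℝ) where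
  toFun u := ρ • u.compContinuousLinearMap s
  map_add' u v := by ext w; simp [mul_add]
  map_smul' c u := by ext w; simp [mul_left_comm]

theorem divergenceForm_smulRight {ρ : ℝ} (hρ : ρ ≠ 0) {B : Model n →L[ℝ] W}
    {s : W →L[ℝ] Model n} (hs : ∀ a, s (B a) = a) (θ : Fin n → W) (ξ : Model n →L[ℝ] ℝ)
    (u : Alt n (p + 1)) :
    divergenceForm ρ B θ (ξ.smulRight (densityForm ρ s u)) =
      -interiorMul (∑ j, ξ (coordVec j) • s (θ j)) u := by
  ext w
  have h2 : interiorMul (∑ j, ξ (coordVec j) • s (θ j)) u w =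
      ∑ j, ξ (coordVec j) * u (Fin.cons (s (θ j)) w) := by
    change u.curryLeft (∑ j, ξ (coordVec j) • s (θ j)) w = _
    rw [map_sum]
    simp [Matrix.vecCons]
  change -(ρ⁻¹ * _) = -(interiorMul _ u w)
  rw [h2]
  congr 1
  change ρ⁻¹ * (∑ j, ((ξ.smulRight (densityForm ρ s u)) (coordVec j)).curryLeft (θ j)) (B ∘ w) = _
  rw [ContinuousAlternatingMap.sum_apply, Finset.mul_sum]
  refine Finset.sum_congr rfl fun j _ => ?_
  have h3 : (s ∘ (Fin.cons (θ j) (B ∘ w) : Fin (p + 1) → W)) = Fin.cons (s (θ j)) w := by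
    funext i
    refine Fin.cases ?_ (fun i => ?_) i
    · rfl
    · exact hs (w i)
  change ρ⁻¹ * (ξ (coordVec j) * (ρ * u (s ∘ (Fin.cons (θ j) (B ∘ w) : Fin (p + 1) → W)))) = _
  rw [h3]
  field_simp

variable {ρ : Model n → ℝ} {B : Model n → Model n →L[ℝ] W} {s : Model n → W →L[ℝ] Model n}
  {θ : Fin n → W}

/-- The operator of which the codifferential is an instance, `W` being the dual space. -/
def divergenceOp (S : Set (Model n)) (ρ : Model n → ℝ) (B : Model n → Model n →L[ℝ] W)
    (s : Model n → W →L[ℝ] Model n) (θ : Fin n → W) (u : Model n → Alt n (p + 1)) :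
    Model n → Alt n p := fun y =>
  divergenceForm (ρ y) (B y) θ (fderivWithin ℝ (fun z => densityForm (ρ z) (s z) (u z)) S y)

theorem contDiffOn_densityForm [FiniteDimensional ℝ W] (hρ : ContDiffOn ℝ ∞ ρ S)
    (hs : ContDiffOn ℝ ∞ s S) {u : Model n → Alt n p} (hu : ContDiffOn ℝ ∞ u S) :
    ContDiffOn ℝ ∞ (fun y => densityForm (ρ y) (s y) (u y)) S :=
  hρ.smul (contDiffOn_compContinuousLinearMap hu hs)

theorem contDiffOn_divergenceForm [FiniteDimensional ℝ W] (hρ : ContDiffOn ℝ ∞ ρ S)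
    (hρ0 : ∀ y ∈ S, ρ y ≠ 0) (hB : ContDiffOn ℝ ∞ B S)
    {A : Model n → Model n →L[ℝ] (W [⋀^Fin (p + 1)]→L[ℝ] ℝ)}
    (hA : ContDiffOn ℝ ∞ A S) :
    ContDiffOn ℝ ∞ (fun y => divergenceForm (ρ y) (B y) θ (A y)) S := by
  refine (ContDiffOn.smul (hρ.inv hρ0)
    (contDiffOn_compContinuousLinearMap (ContDiffOn.sum fun j _ => ?_) hB)).neg
  have h1 : ContDiffOn ℝ ∞ (fun y => A y (coordVec j)) S := hA.clm_apply contDiffOn_const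
  exact contDiffOn_alt_iff.2 fun w => contDiffOn_alt_iff.1 h1 _

theorem isDiffOp_divergenceOp [FiniteDimensional ℝ W] (hS : UniqueDiffOn ℝ S)
    (hρ : ContDiffOn ℝ ∞ ρ S) (hρ0 : ∀ y ∈ S, ρ y ≠ 0) (hB : ContDiffOn ℝ ∞ B S)
    (hs : ContDiffOn ℝ ∞ s S) (hsB : ∀ y ∈ S, ∀ a, s y (B y a) = a) :
    IsDiffOp S 1 (divergenceOp (p := p) S ρ B s θ)
      (fun y ξ => -interiorMul (∑ j, ξ (coordVec j) • s y (θ j))) := by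
  refine IsDiffOp.of_leibniz hS (fun u hu => ?_) (fun u v h y hy => ?_)
    (fun c u v hu hv y hy => ?_) (fun y _ c ξ => ?_) fun h u hh hu y hy => ?_
  · exact contDiffOn_divergenceForm hρ hρ0 hB
      ((contDiffOn_densityForm hρ hs hu).fderivWithin hS le_rfl)
  · unfold divergenceOp
    congr 1
    exact fderivWithin_congr' (fun z hz => by simp only [h hz]) hy
  · have hud := (contDiffOn_densityForm hρ hs hu).differentiableOn (by simp) y hy
    have hvd := (contDiffOn_densityForm hρ hs hv).differentiableOn (by simp) y hy
    have h1 := fderivWithin_sub (hS y hy) hud (hvd.const_smul c)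
    have h2 := fderivWithin_const_smul_field (𝕜 := ℝ) (R := ℝ)
      (f := fun y => densityForm (ρ y) (s y) (v y)) c (hS y hy)
    simp only [Pi.sub_apply, Pi.smul_apply, divergenceOp]
    rw [← map_smul, ← map_sub, ← h2, ← h1]
    congr 2
    funext z
    simp
  · have : ∑ j, (c • ξ) (coordVec j) • s y (θ j) = c • ∑ j, ξ (coordVec j) • s y (θ j) := by
      simp [Finset.smul_sum, smul_smul]
    rw [this, interiorMul_smul_left, smul_neg]
  · have hud := (contDiffOn_densityForm hρ hs hu).differentiableOn (by simp) y hy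
    have hhd := hh.differentiableOn (by simp) y hy
    unfold divergenceOp
    rw [LinearMap.neg_apply, ← divergenceForm_smulRight (hρ0 y hy) (hsB y hy), ← map_smul,
      ← map_add, ← fderivWithin_fun_smul (hS y hy) hhd hud]
    simp

end Divergence

theorem isDiffOp_localCodiff (hS : UniqueDiffOn ℝ S) (hG : IsMetricOn S G) :
    IsDiffOp S 1 (localCodiff (p := p) S G) (fun y ξ => -interiorMul (sharp (G y) ξ)) := by
  have h : IsDiffOp S 1 (localCodiff (p := p) S G) _ :=
    isDiffOp_divergenceOp (p := p) (θ := coordCovec) hS hG.contDiffOn_volDensity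
      (fun y hy => (volDensity_pos (hG.symm y hy) (hG.pos y hy)).ne') hG.smooth
      hG.contDiffOn_sharp fun y hy => sharp_flat (hG.pos y hy)
  refine h.congr_symbol fun y _ ξ => ?_
  have : ξ = ∑ j, ξ (coordVec j) • coordCovec j := by
    ext a
    conv_lhs => rw [← sum_coordCovec_smul_coordVec a]
    simp [mul_comm]
  conv_rhs => rw [this]
  simp

/-- The square norm `|ξ|²` of a covector. -/
def normSq (G : Bilin n) (ξ : Model n →L[ℝ] ℝ) : ℝ := ξ (sharp G ξ)

theorem isDiffOp_localLaplacian (hS : UniqueDiffOn ℝ S) (hG : IsMetricOn S G) (p : ℕ) :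
    IsDiffOp S 2 (localLaplacian S G p) (fun y ξ => -normSq (G y) ξ • LinearMap.id) := by
  cases p with
  | zero =>
    refine ((isDiffOp_localCodiff hS hG).comp (isDiffOp_localD hS)).congr_symbol fun y _ ξ => ?_
    refine LinearMap.ext fun u => ?_
    simp [interiorMul_wedge_zero, normSq]
  | succ p =>
    refine (((isDiffOp_localD hS).comp (isDiffOp_localCodiff hS hG)).add
      ((isDiffOp_localCodiff hS hG).comp (isDiffOp_localD hS))).congr_symbol fun y _ ξ => ?_
    refine LinearMap.ext fun u => ?_
    simp [interiorMul_wedge, normSq, neg_add_eq_sub]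

theorem isDiffOp_localLaplacianD (hS : UniqueDiffOn ℝ S) (hG : IsMetricOn S G) (p : ℕ) :
    IsDiffOp S 3 (fun u : Model n → Alt n p => localLaplacian S G (p + 1) (localD S u))
      (fun y ξ => -normSq (G y) ξ • wedge ξ) :=
  ((isDiffOp_localLaplacian hS hG (p + 1)).comp (isDiffOp_localD hS)).congr_symbol
    fun _ _ _ => rfl

theorem isDiffOp_localBiLaplacian (hS : UniqueDiffOn ℝ S) (hG : IsMetricOn S G) (p : ℕ) :
    IsDiffOp S 4 (fun u => localLaplacian S G p (localLaplacian S G p u))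
      (fun y ξ => normSq (G y) ξ ^ 2 • LinearMap.id) :=
  ((isDiffOp_localLaplacian hS hG p).comp (isDiffOp_localLaplacian hS hG p)).congr_symbol
    fun y _ ξ => LinearMap.ext fun u => by
      change -normSq (G y) ξ • -normSq (G y) ξ • u = normSq (G y) ξ ^ 2 • u
      rw [smul_smul, neg_mul_neg, sq]

end Metric

/-! ### Principal symbols on the manifold -/

section Commutator

variable {n p : ℕ} [NeZero n] {M X V W W' : Type*} [AddCommGroup V] [Module ℝ V]
  [AddCommGroup W] [Module ℝ W] [AddCommGroup W'] [Module ℝ W']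

theorem commutator_iterate_add (π : X → M) (f : M → ℝ) (A B : (M → V) → X → W) (k : ℕ) :
    (commutator π f)^[k] (fun η x => A η x + B η x) =
      fun η x => (commutator π f)^[k] A η x + (commutator π f)^[k] B η x := by
  induction k with
  | zero => rfl
  | succ k ih =>
    rw [Function.iterate_succ_apply', ih, Function.iterate_succ_apply',
      Function.iterate_succ_apply']
    funext η x
    simp only [commutator, smul_add]
    abel

theorem commutator_iterate_comp (π : X → M) (f : M → ℝ) (A : (M → V) → M → W)
    (T : X → W →ₗ[ℝ] W') (k : ℕ) :
    (commutator π f)^[k] (fun η x => T x (A η (π x))) =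
      fun η x => T x ((commutator id f)^[k] A η (π x)) := by
  induction k with
  | zero => rfl
  | succ k ih =>
    rw [Function.iterate_succ_apply', ih, Function.iterate_succ_apply']
    funext η x
    simp [commutator]

variable [TopologicalSpace M] [ChartedSpace (EuclideanHalfSpace n) M]

theorem HasPrincipalSymbolAt.add {π : X → M} {A B : (M → Alt n p) → X → W} {k : ℕ} {x : X}
    {σ τ : (Model n →L[ℝ] ℝ) → Alt n p →ₗ[ℝ] W} (hA : HasPrincipalSymbolAt π A k x σ)
    (hB : HasPrincipalSymbolAt π B k x τ) :
    HasPrincipalSymbolAt π (fun η x => A η x + B η x) k x (fun ξ => σ ξ + τ ξ) := by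
  intro f hf η hη
  rw [commutator_iterate_add]
  simp only [smul_add, LinearMap.add_apply]
  rw [hA f hf η hη, hB f hf η hη]

theorem HasPrincipalSymbolAt.comp {π : X → M} {A : (M → Alt n p) → M → W} {k : ℕ} {x : X}
    {σ : (Model n →L[ℝ] ℝ) → Alt n p →ₗ[ℝ] W} (hA : HasPrincipalSymbolAt id A k (π x) σ)
    (T : X → W →ₗ[ℝ] W') :
    HasPrincipalSymbolAt π (fun η x => T x (A η (π x))) k x (fun ξ => T x ∘ₗ σ ξ) := by
  intro f hf η hη
  rw [commutator_iterate_comp]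
  have := hA f hf η hη
  rw [id] at this
  rw [LinearMap.comp_apply, ← this, map_smul]

end Commutator

section Manifold

variable {n p q : ℕ} [NeZero n] {M : Type*} [TopologicalSpace M]
  [ChartedSpace (EuclideanHalfSpace n) M]

theorem chartForm_smul (f : M → ℝ) (η : M → Alt n p) (x : M) :
    chartForm (fun z => f z • η z) x =
      fun y => f ((extChartAt (𝓡∂ n) x).symm y) • chartForm η x y := rfl

theorem chartForm_sub_smul (c : ℝ) (η ζ : M → Alt n p) (x : M) :
    chartForm (η - c • ζ) x = chartForm η x - c • chartForm ζ x := by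
  funext y
  ext w
  simp [chartForm]

variable [IsManifold (𝓡∂ n) ∞ M]

theorem contDiffOn_comp_extChartAt_symm {f : M → ℝ} (hf : ContMDiff (𝓡∂ n) 𝓘(ℝ, ℝ) ∞ f) (x : M) :
    ContDiffOn ℝ ∞ (fun y => f ((extChartAt (𝓡∂ n) x).symm y))
      (extChartAt (𝓡∂ n) x).target :=
  contMDiffOn_iff_contDiffOn.1 (hf.comp_contMDiffOn (contMDiffOn_extChartAt_symm x))

theorem IsSmoothForm.smul {η : M → Alt n p} (hη : IsSmoothForm η) {f : M → ℝ}
    (hf : ContMDiff (𝓡∂ n) 𝓘(ℝ, ℝ) ∞ f) : IsSmoothForm (fun z => f z • η z) := fun x => by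
  rw [chartForm_smul]
  exact (contDiffOn_comp_extChartAt_symm hf x).smul (hη x)

theorem chartFrame_self (x : M) :
    chartFrame x (extChartAt (𝓡∂ n) x x) = ContinuousLinearMap.id ℝ (Model n) := by
  have hI : IsManifold (𝓡∂ n) 1 M := IsManifold.of_le (n := ∞) (by simp)
  have := TangentBundle.symmL_trivializationAt (I := 𝓡∂ n) (mem_chart_source _ x)
  refine (this.symm.trans ?_)
  rw [TangentBundle.symmL_trivializationAt_eq_core (mem_chart_source _ x)]
  ext v : 1
  exact (tangentBundleCore (𝓡∂ n) M).coordChange_self _ x (mem_chart_source _ x) v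

theorem chartForm_self (η : M → Alt n p) (x : M) :
    chartForm η x (extChartAt (𝓡∂ n) x x) = η x := by
  rw [chartForm, chartFrame_self, extChartAt_to_inv]
  ext; rfl

theorem chartMetric_self (g : Metric n M) (x : M) :
    chartMetric g x (extChartAt (𝓡∂ n) x x) = metricAt g x := by
  rw [chartMetric, chartFrame_self, extChartAt_to_inv]
  ext; rfl

theorem differential_eq_fderivWithin {f : M → ℝ} (hf : ContMDiff (𝓡∂ n) 𝓘(ℝ, ℝ) ∞ f) (x : M) :
    differential f x = fderivWithin ℝ (fun y => f ((extChartAt (𝓡∂ n) x).symm y))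
      (extChartAt (𝓡∂ n) x).target (extChartAt (𝓡∂ n) x x) := by
  have h : MDifferentiableAt (𝓡∂ n) 𝓘(ℝ, ℝ) f x := hf.mdifferentiableAt (by simp)
  have hd : DifferentiableWithinAt ℝ (fun y => f ((extChartAt (𝓡∂ n) x).symm y)) (range (𝓡∂ n))
      (extChartAt (𝓡∂ n) x x) := h.differentiableWithinAt_writtenInExtChartAt
  refine Eq.trans (if_pos h) ?_
  exact (hd.hasFDerivWithinAt.mono (extChartAt_target_subset_range x)).fderivWithin
    (uniqueDiffOn_extChartAt_target x _ (mem_extChartAt_target x)) |>.symm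

theorem commutator_iterate_apply {X W : Type*} [AddCommGroup W] [Module ℝ W] (π : X → M)
    {A : (M → Alt n p) → X → W} {x : X}
    (hA : ∀ η ζ, IsSmoothForm η → IsSmoothForm ζ → ∀ c : ℝ,
      A (η - c • ζ) x = A η x - c • A ζ x)
    {f : M → ℝ} (hf : ContMDiff (𝓡∂ n) 𝓘(ℝ, ℝ) ∞ f) (k : ℕ) {η : M → Alt n p}
    (hη : IsSmoothForm η) :
    (commutator π f)^[k] A η x = A (fun z => (f z - f (π x)) ^ k • η z) x := by
  induction k generalizing η with
  | zero => simp
  | succ k ih =>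
    rw [Function.iterate_succ_apply', commutator, ih (hη.smul hf), ih hη, ← hA]
    · congr 1
      funext z
      ext w
      simp
      ring
    · exact (hη.smul hf).smul ((hf.sub contMDiff_const).pow k)
    · exact hη.smul ((hf.sub contMDiff_const).pow k)

theorem hasPrincipalSymbolAt_inChart (g : Metric n M) {k : ℕ} (x : M)
    {L : Set (Model n) → (Model n → Bilin n) → (Model n → Alt n p) → Model n → Alt n q}
    {σ : Model n → (Model n →L[ℝ] ℝ) → Alt n p →ₗ[ℝ] Alt n q}
    (hL : IsDiffOp (extChartAt (𝓡∂ n) x).target k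
      (L (extChartAt (𝓡∂ n) x).target (chartMetric g x)) σ) :
    HasPrincipalSymbolAt id (inChart g L) k x (σ (extChartAt (𝓡∂ n) x x)) := by
  intro f hf η hη
  have hx := mem_extChartAt_target (I := 𝓡∂ n) x
  rw [commutator_iterate_apply id (fun η ζ hη hζ c => ?_) hf k hη]
  · set h : Model n → ℝ := fun y => f ((extChartAt (𝓡∂ n) x).symm y) - f x with hh
    obtain ⟨w, -, hLw, hw0⟩ := hL.symbol h (chartForm η x)
      ((contDiffOn_comp_extChartAt_symm hf x).sub contDiffOn_const) (hη x) 0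
    have h0 : h (extChartAt (𝓡∂ n) x x) = 0 := by
      simp only [hh]
      rw [extChartAt_to_inv, sub_self]
    have h1 : inChart g L (fun z => (f z - f x) ^ k • η z) x = w (extChartAt (𝓡∂ n) x x) := by
      have := hLw hx
      simp only [zero_add, pow_zero, one_smul] at this
      exact this
    rw [id, h1, hw0 _ hx h0, chartForm_self, smul_smul, differential_eq_fderivWithin hf, hh,
      fderivWithin_sub_const]
    have := Nat.factorial_ne_zero k
    simp [this]
  · have := hL.map_sub_smul c _ _ (hη x) (hζ x) hx
    rw [inChart, chartForm_sub_smul]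
    exact this

theorem HasPrincipalSymbolAt.succ {X W : Type*} [AddCommGroup W] [Module ℝ W] {π : X → M}
    {A : (M → Alt n p) → X → W} {k : ℕ} {x : X} {σ : (Model n →L[ℝ] ℝ) → Alt n p →ₗ[ℝ] W}
    (hA : HasPrincipalSymbolAt π A k x σ) :
    HasPrincipalSymbolAt π A (k + 1) x (fun _ => 0) := by
  have key : ∀ f : M → ℝ, ContMDiff (𝓡∂ n) 𝓘(ℝ, ℝ) ∞ f → ∀ η : M → Alt n p, IsSmoothForm η →
      (commutator π f)^[k] A η x = (k.factorial : ℝ) • σ (differential f (π x)) (η (π x)) := by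
    intro f hf η hη
    rw [← hA f hf η hη, smul_smul, mul_inv_cancel₀ (by exact_mod_cast k.factorial_ne_zero),
      one_smul]
  intro f hf η hη
  rw [Function.iterate_succ_apply', commutator, key f hf _ (hη.smul hf), key f hf η hη]
  simp [smul_comm (f (π x))]

theorem chartFrame_eq_symmL [IsManifold (𝓡∂ n) 1 M] (x : M) {y : Model n}
    (hy : y ∈ (extChartAt (𝓡∂ n) x).target) :
    chartFrame x y = (trivializationAt (Model n) (TangentSpace (𝓡∂ n)) x).symmL ℝ
      ((extChartAt (𝓡∂ n) x).symm y) := by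
  have hs : (extChartAt (𝓡∂ n) x).symm y ∈ (chartAt (EuclideanHalfSpace n) x).source := by
    rw [← extChartAt_source (𝓡∂ n)]
    exact (extChartAt (𝓡∂ n) x).map_target hy
  refine Eq.trans ?_ (TangentBundle.symmL_trivializationAt (I := 𝓡∂ n) hs).symm
  rw [(extChartAt (𝓡∂ n) x).right_inv hy]
  rfl

theorem symm_mem_baseSet [IsManifold (𝓡∂ n) 1 M] (x : M) {y : Model n}
    (hy : y ∈ (extChartAt (𝓡∂ n) x).target) : (extChartAt (𝓡∂ n) x).symm y ∈
      (trivializationAt (Model n) (TangentSpace (𝓡∂ n) (M := M)) x).baseSet := by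
  rw [TangentBundle.trivializationAt_baseSet, ← extChartAt_source (𝓡∂ n)]
  exact (extChartAt (𝓡∂ n) x).map_target hy

theorem chartFrame_injective (x : M) {y : Model n} (hy : y ∈ (extChartAt (𝓡∂ n) x).target)
    {a : Model n} (ha : chartFrame x y a = 0) : a = 0 := by
  have hI : IsManifold (𝓡∂ n) 1 M := IsManifold.of_le (n := ∞) (by simp)
  rw [chartFrame_eq_symmL x hy] at ha
  have h := (trivializationAt (Model n) (TangentSpace (𝓡∂ n) (M := M)) x).continuousLinearMapAt_symmL
    (R := ℝ) (symm_mem_baseSet x hy) a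
  have h2 := congrArg ((trivializationAt (Model n) (TangentSpace (𝓡∂ n)
    (M := M)) x).continuousLinearMapAt ℝ ((extChartAt (𝓡∂ n) x).symm y)) ha
  exact h.symm.trans (h2.trans (map_zero _))

theorem contMDiffOn_chartFrame (x : M) (a : Model n) :
    ContMDiffOn 𝓘(ℝ, Model n) (𝓡∂ n).tangent ∞
      (fun y => (Bundle.TotalSpace.mk ((extChartAt (𝓡∂ n) x).symm y) (chartFrame x y a) :
        TangentBundle (𝓡∂ n) M)) (extChartAt (𝓡∂ n) x).target := by
  have hI : IsManifold (𝓡∂ n) 1 M := IsManifold.of_le (n := ∞) (by simp)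
  have hI' : IsManifold (𝓡∂ n) (∞ + 1) M := by simpa using (inferInstance : IsManifold (𝓡∂ n) ∞ M)
  have h1 := (trivializationAt (Model n) (TangentSpace (𝓡∂ n) (M := M)) x).contMDiffOn_symm
    (n := ∞) (IB := 𝓡∂ n)
  have h2 : ContMDiffOn 𝓘(ℝ, Model n) ((𝓡∂ n).prod 𝓘(ℝ, Model n)) ∞
      (fun y => ((extChartAt (𝓡∂ n) x).symm y, a)) (extChartAt (𝓡∂ n) x).target :=
    (contMDiffOn_extChartAt_symm x).prodMk contMDiffOn_const
  have h3 := h1.comp h2 fun y hy => by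
    rw [mem_preimage, Bundle.Trivialization.mem_target]
    exact symm_mem_baseSet x hy
  refine h3.congr fun y hy => ?_
  rw [chartFrame_eq_symmL x hy]
  refine Eq.trans (congrArg (Bundle.TotalSpace.mk _)
    (Bundle.Trivialization.symmL_apply (R := ℝ) _ (symm_mem_baseSet x hy) a)) ?_
  exact Bundle.Trivialization.mk_symm _ (symm_mem_baseSet x hy) a

theorem contDiffOn_chartMetric (g : Metric n M) (x : M) :
    ContDiffOn ℝ ∞ (chartMetric g x) (extChartAt (𝓡∂ n) x).target := by
  refine contDiffOn_clm_apply.2 fun a => contDiffOn_clm_apply.2 fun b => ?_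
  rw [← contMDiffOn_iff_contDiffOn]
  intro y hy
  have hv := contMDiffOn_chartFrame x a y hy
  have hw := contMDiffOn_chartFrame x b y hy
  have hb : ContMDiffWithinAt 𝓘(ℝ, Model n) (𝓡∂ n) ∞ (extChartAt (𝓡∂ n) x).symm
    (extChartAt (𝓡∂ n) x).target y := contMDiffOn_extChartAt_symm x y hy
  have : ContMDiffWithinAt 𝓘(ℝ, Model n) ((𝓡∂ n).prod 𝓘(ℝ)) ∞
      (fun m ↦ Bundle.TotalSpace.mk' ℝ (E := Bundle.Trivial M ℝ) ((extChartAt (𝓡∂ n) x).symm m)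
        (g.inner ((extChartAt (𝓡∂ n) x).symm m) (chartFrame x m a) (chartFrame x m b)))
      (extChartAt (𝓡∂ n) x).target y := by
    apply ContMDiffWithinAt.clm_bundle_apply₂ (F₁ := Model n) (F₂ := Model n)
    · exact ContMDiffAt.comp_contMDiffWithinAt y g.contMDiff.contMDiffAt hb
    · exact hv
    · exact hw
  simp only [Bundle.contMDiffWithinAt_totalSpace] at this
  exact this.2

theorem metricAt_symm (g : Metric n M) (x : M) (a b : Model n) :
    metricAt g x a b = metricAt g x b a := g.symm x a b

theorem metricAt_pos (g : Metric n M) (x : M) (a : Model n) (ha : a ≠ 0) :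
    0 < metricAt g x a a := g.pos x a ha

theorem chartMetric_apply (g : Metric n M) (x : M) (y a b : Model n) :
    chartMetric g x y a b =
      metricAt g ((extChartAt (𝓡∂ n) x).symm y) (chartFrame x y a) (chartFrame x y b) := rfl

theorem isMetricOn_chartMetric (g : Metric n M) (x : M) :
    IsMetricOn (extChartAt (𝓡∂ n) x).target (chartMetric g x) := by
  refine ⟨contDiffOn_chartMetric g x, fun y _ a b => ?_, fun y hy a ha => ?_⟩
  · rw [chartMetric_apply, chartMetric_apply, metricAt_symm]
  · rw [chartMetric_apply]
    exact metricAt_pos _ _ _ fun h0 => ha (chartFrame_injective x hy h0)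

/-! ### The symbols of the operators -/

section Symbols

variable (g : Metric n M) (x : M)

theorem hasPrincipalSymbolAt_extD :
    HasPrincipalSymbolAt id (extD (p := p) g) 1 x wedge :=
  hasPrincipalSymbolAt_inChart g x (L := fun S _ u => localD S u)
    (isDiffOp_localD (uniqueDiffOn_extChartAt_target x))

theorem hasPrincipalSymbolAt_codiff :
    HasPrincipalSymbolAt id (codiff (p := p) g) 1 x
      (fun ξ => -interiorMul (sharp (metricAt g x) ξ)) := by
  have := hasPrincipalSymbolAt_inChart g x (L := fun S G u => localCodiff S G u)
    (isDiffOp_localCodiff (p := p) (uniqueDiffOn_extChartAt_target x) (isMetricOn_chartMetric g x))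
  rwa [chartMetric_self] at this

theorem hasPrincipalSymbolAt_laplacian :
    HasPrincipalSymbolAt id (laplacian (p := p) g) 2 x
      (fun ξ => -normSq (metricAt g x) ξ • LinearMap.id) := by
  have := hasPrincipalSymbolAt_inChart g x (L := fun S G u => localLaplacian S G p u)
    (isDiffOp_localLaplacian (uniqueDiffOn_extChartAt_target x) (isMetricOn_chartMetric g x) p)
  rwa [chartMetric_self] at this

theorem hasPrincipalSymbolAt_laplacianD :
    HasPrincipalSymbolAt id (laplacianD (p := p) g) 3 x
      (fun ξ => -normSq (metricAt g x) ξ • wedge ξ) := by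
  have := hasPrincipalSymbolAt_inChart g x
    (L := fun S G u => localLaplacian S G (p + 1) (localD S u))
    (isDiffOp_localLaplacianD (uniqueDiffOn_extChartAt_target x) (isMetricOn_chartMetric g x) p)
  rwa [chartMetric_self] at this

theorem hasPrincipalSymbolAt_biLaplacian :
    HasPrincipalSymbolAt id (biLaplacian (p := p) g) 4 x
      (fun ξ => normSq (metricAt g x) ξ ^ 2 • LinearMap.id) := by
  have := hasPrincipalSymbolAt_inChart g x
    (L := fun S G u => localLaplacian S G p (localLaplacian S G p u))
    (isDiffOp_localBiLaplacian (uniqueDiffOn_extChartAt_target x) (isMetricOn_chartMetric g x) p)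
  rwa [chartMetric_self] at this

theorem hasPrincipalSymbolAt_id :
    HasPrincipalSymbolAt id (fun η : M → Alt n p => η) 0 x (fun _ => LinearMap.id) := by
  intro f _ η _
  simp

end Symbols

/-- `ι*` as a linear map. -/
def restrictL : Alt n q →ₗ[ℝ] BdryAlt n q where
  toFun := restrict
  map_add' _ _ := rfl
  map_smul' _ _ := rfl

/-- `ν ⌟ ·` as a linear map. -/
def contractL (ν : Model n) : Alt n (q + 1) →ₗ[ℝ] BdryAlt n q := restrictL ∘ₗ interiorMul ν

section BoundarySymbols

variable (g : Metric n M) (x : (𝓡∂ n).boundary M)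

theorem hasPrincipalSymbolAt_opNormal :
    HasPrincipalSymbolAt Subtype.val (opNormal (p := p) g).toFun 0 x
      (fun _ => contractL (normal g x.1)) :=
  (hasPrincipalSymbolAt_id x.1).comp (π := Subtype.val)
    fun x : (𝓡∂ n).boundary M => contractL (normal g x.1)

theorem hasPrincipalSymbolAt_opNormalD :
    HasPrincipalSymbolAt Subtype.val (opNormalD (p := p) g).toFun 1 x
      (fun ξ => contractL (normal g x.1) ∘ₗ wedge ξ) :=
  (hasPrincipalSymbolAt_extD g x.1).comp (π := Subtype.val)
    fun x : (𝓡∂ n).boundary M => contractL (normal g x.1)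

theorem hasPrincipalSymbolAt_opCodiff :
    HasPrincipalSymbolAt Subtype.val (opCodiff (p := p) g).toFun 1 x
      (fun ξ => -(restrictL ∘ₗ interiorMul (sharp (metricAt g x.1) ξ))) :=
  (hasPrincipalSymbolAt_codiff (p := p) g x.1).comp (π := Subtype.val)
    fun _ : (𝓡∂ n).boundary M => restrictL

theorem hasPrincipalSymbolAt_opNormalLap (l : ℝ) :
    HasPrincipalSymbolAt Subtype.val (opNormalLap (p := p) g l).toFun 2 x
      (fun ξ => -normSq (metricAt g x.1) ξ • contractL (normal g x.1)) := by
  have h1 := (hasPrincipalSymbolAt_laplacian (p := p + 1) g x.1).comp (π := Subtype.val)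
    fun x : (𝓡∂ n).boundary M => contractL (normal g x.1)
  have h2 := ((hasPrincipalSymbolAt_codiff (p := p) g x.1).comp (π := Subtype.val)
    fun _ : (𝓡∂ n).boundary M => l • restrictL (n := n) (q := p)).succ
  have h3 := h1.add h2
  simp only [add_zero, LinearMap.comp_smul, LinearMap.comp_id] at h3
  exact h3

theorem hasPrincipalSymbolAt_opNormalLapD (l : ℝ) :
    HasPrincipalSymbolAt Subtype.val (opNormalLapD (p := p) g l).toFun 3 x
      (fun ξ => -normSq (metricAt g x.1) ξ • (contractL (normal g x.1) ∘ₗ wedge ξ)) := by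
  have h1 := (hasPrincipalSymbolAt_laplacianD (p := p) g x.1).comp (π := Subtype.val)
    fun x : (𝓡∂ n).boundary M => contractL (normal g x.1)
  have h2 := ((hasPrincipalSymbolAt_id (p := p) x.1).comp (π := Subtype.val)
    fun _ : (𝓡∂ n).boundary M => l • restrictL (n := n) (q := p)).succ.succ.succ
  have h3 := h1.add h2
  simp only [add_zero, LinearMap.comp_smul] at h3
  exact h3

end BoundarySymbols

end Manifold

/-! ### Bounded solutions of `(∂² - L²)² y = 0` -/

section ODE

variable {E : Type*} [NormedAddCommGroup E] [NormedSpace ℝ E]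

theorem exists_forall_eq_of_hasDerivAt_zero {z : ℝ → E} (h : ∀ t, HasDerivAt z 0 t) :
    ∃ c, ∀ t, z t = c :=
  ⟨z 0, fun t => is_const_of_deriv_eq_zero (fun s => (h s).differentiableAt)
    (fun s => (h s).deriv) t 0⟩

theorem hasDerivAt_exp_mul (m t : ℝ) :
    HasDerivAt (fun t => Real.exp (m * t)) (m * Real.exp (m * t)) t := by
  simpa [mul_comm] using ((hasDerivAt_id t).const_mul m).exp

/-- The solutions of `(∂ - m)² z = 0`. -/
theorem exists_eq_exp_smul {m : ℝ} {z z₁ z₂ : ℝ → E} (h₀ : ∀ t, HasDerivAt z (z₁ t) t)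
    (h₁ : ∀ t, HasDerivAt z₁ (z₂ t) t)
    (h : ∀ t, z₂ t - (2 * m) • z₁ t + (m ^ 2) • z t = 0) :
    ∃ c d : E, ∀ t, z t = Real.exp (m * t) • (c + t • d) ∧
      z₁ t = m • z t + Real.exp (m * t) • d := by
  have hexp : ∀ t, Real.exp (m * t) * Real.exp (-m * t) = 1 := fun t => by
    rw [← Real.exp_add]; simp
  obtain ⟨d, hd⟩ := exists_forall_eq_of_hasDerivAt_zero
    (z := fun t => Real.exp (-m * t) • (z₁ t - m • z t)) fun t => by
      have h1 : HasDerivAt (fun t => z₁ t - m • z t) (z₂ t - m • z₁ t) t :=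
        (h₁ t).sub ((h₀ t).const_smul m)
      refine ((hasDerivAt_exp_mul (-m) t).smul h1).congr_deriv ?_
      linear_combination (norm := module) Real.exp (-m * t) • h t
  obtain ⟨c, hc⟩ := exists_forall_eq_of_hasDerivAt_zero
    (z := fun t => Real.exp (-m * t) • z t - t • d) fun t => by
      have h1 : HasDerivAt (fun t : ℝ => t • d) ((1 : ℝ) • d) t := (hasDerivAt_id t).smul_const d
      refine (((hasDerivAt_exp_mul (-m) t).smul (h₀ t)).sub h1).congr_deriv ?_
      linear_combination (norm := module) hd t
  refine ⟨c, d, fun t => ⟨?_, ?_⟩⟩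
  · rw [← hc t, sub_add_cancel, smul_smul, hexp, one_smul]
  · rw [← hd t, smul_smul, hexp, one_smul]
    abel

theorem eq_zero_of_norm_exp_smul_le {L : ℝ} (hL : 0 < L) {c d : E} {K : ℝ}
    (h : ∀ t, 0 ≤ t → ‖Real.exp (L * t) • (c + t • d)‖ ≤ K) : c = 0 ∧ d = 0 := by
  have hexp : Tendsto (fun t : ℝ => K * Real.exp (-(L * t))) atTop (𝓝 0) := by
    have := (Real.tendsto_exp_neg_atTop_nhds_zero.comp
      (tendsto_id.const_mul_atTop hL)).const_mul K
    simpa using this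
  have hz : Tendsto (fun t : ℝ => c + t • d) atTop (𝓝 0) := by
    refine squeeze_zero_norm' ?_ hexp
    filter_upwards [eventually_ge_atTop 0] with t ht
    have := h t ht
    rw [norm_smul, Real.norm_eq_abs, Real.abs_exp] at this
    rw [Real.exp_neg, ← div_eq_mul_inv, le_div_iff₀ (Real.exp_pos _)]
    linarith
  have hz1 : Tendsto (fun t : ℝ => c + (t + 1) • d) atTop (𝓝 0) :=
    hz.comp (tendsto_atTop_add_const_right _ 1 tendsto_id)
  have hd : d = 0 := by
    have := hz1.sub hz
    simp only [sub_zero] at this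
    refine tendsto_nhds_unique (tendsto_const_nhds.congr fun t => ?_) this
    module
  subst hd
  refine ⟨?_, rfl⟩
  simpa [tendsto_const_nhds_iff] using hz

/-- The curve `t ↦ e^{-Lt} (a + t b)`. -/
def decayCurve (L : ℝ) (a b : E) (t : ℝ) : E := Real.exp (-L * t) • (a + t • b)

theorem hasDerivAt_decayCurve (L : ℝ) (a b : E) (t : ℝ) :
    HasDerivAt (decayCurve L a b) (decayCurve L (b - L • a) (-L • b) t) t := by
  have := (hasDerivAt_exp_mul (-L) t).smul (((hasDerivAt_id t).smul_const b).const_add a)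
  convert! this using 1
  simp only [decayCurve, id]
  module

theorem contDiff_decayCurve (L : ℝ) (a b : E) : ContDiff ℝ ∞ (decayCurve L a b) :=
  (Real.contDiff_exp.comp (contDiff_const.mul contDiff_id)).smul
    (contDiff_const.add (contDiff_id.smul contDiff_const))

theorem iteratedDeriv_decayCurve (L : ℝ) (a b : E) (j : ℕ) :
    iteratedDeriv j (decayCurve L a b) =
      decayCurve L ((-L) ^ j • a + (j * (-L) ^ (j - 1)) • b) ((-L) ^ j • b) := by
  induction j with
  | zero => simp
  | succ j ih =>
    rw [iteratedDeriv_succ, ih]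
    funext t
    rw [(hasDerivAt_decayCurve _ _ _ _).deriv]
    congr 1
    · rcases j with _ | j
      · simp; abel
      · simp only [Nat.add_sub_cancel, pow_succ]
        push_cast
        module
    · rw [pow_succ]
      module

theorem decayCurve_zero (L : ℝ) (a b : E) : decayCurve L a b 0 = a := by simp [decayCurve]

theorem exists_norm_decayCurve_le {L : ℝ} (hL : 0 < L) (a b : E) :
    ∃ C, ∀ t, 0 ≤ t → ‖decayCurve L a b t‖ ≤ C := by
  refine ⟨‖a‖ + L⁻¹ * ‖b‖, fun t ht => ?_⟩
  have h1 : Real.exp (-L * t) ≤ 1 := Real.exp_le_one_iff.2 (by nlinarith)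
  have h2 : Real.exp (-L * t) * t ≤ L⁻¹ := by
    rw [neg_mul, Real.exp_neg, inv_mul_le_iff₀ (Real.exp_pos _), ← div_eq_mul_inv,
      le_div_iff₀ hL]
    linarith [Real.add_one_le_exp (L * t)]
  have h0 := Real.exp_pos (-L * t)
  calc ‖decayCurve L a b t‖ ≤ Real.exp (-L * t) * (‖a‖ + t * ‖b‖) := by
        rw [decayCurve, norm_smul, Real.norm_eq_abs, Real.abs_exp]
        gcongr
        refine (norm_add_le _ _).trans ?_
        rw [norm_smul, Real.norm_of_nonneg ht]
    _ = Real.exp (-L * t) * ‖a‖ + (Real.exp (-L * t) * t) * ‖b‖ := by ring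
    _ ≤ ‖a‖ + L⁻¹ * ‖b‖ := by
        gcongr
        exact mul_le_of_le_one_left (norm_nonneg _) h1

theorem exists_eq_decayCurve {L : ℝ} (hL : 0 < L) {y : ℝ → E} (hy : ContDiff ℝ ∞ y)
    (h : ∀ t, L ^ 4 • y t - (2 * L ^ 2) • iteratedDeriv 2 y t + iteratedDeriv 4 y t = 0)
    {K : ℝ} (hK : ∀ t, 0 ≤ t → ‖y t‖ ≤ K) : ∃ a b, y = decayCurve L a b := by
  set Y : ℕ → ℝ → E := fun j => iteratedDeriv j y with hYdef
  have hY : ∀ j t, HasDerivAt (Y j) (Y (j + 1) t) t := fun j t => by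
    simp only [hYdef]
    rw [iteratedDeriv_succ]
    exact ((hy.differentiable_iteratedDeriv j (by exact_mod_cast WithTop.coe_lt_top _)) t).hasDerivAt
  have hY0 : Y 0 = y := iteratedDeriv_zero
  have hcomb : ∀ (m : ℝ) j t, HasDerivAt (fun t => Y (j + 2) t + (2 * m) • Y (j + 1) t + m ^ 2 • Y j t)
      (Y (j + 1 + 2) t + (2 * m) • Y (j + 1 + 1) t + m ^ 2 • Y (j + 1) t) t := fun m j t =>
    ((hY (j + 2) t).add ((hY (j + 1) t).const_smul _)).add ((hY j t).const_smul _)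
  have h' : ∀ t, L ^ 4 • Y 0 t - (2 * L ^ 2) • Y 2 t + Y 4 t = 0 := fun t => by
    rw [hY0]; exact h t
  obtain ⟨c, d, hw⟩ := exists_eq_exp_smul (m := L) (hcomb L 0) (hcomb L 1) fun t => by
    rw [← h' t]
    simp only [Nat.reduceAdd]
    module
  obtain ⟨a, b, hu⟩ := exists_eq_exp_smul (m := -L) (hcomb (-L) 0) (hcomb (-L) 1) fun t => by
    rw [← h' t]
    simp only [Nat.reduceAdd]
    module
  obtain ⟨d, rfl⟩ : ∃ d', d = L • d' := ⟨L⁻¹ • d, by rw [smul_smul, mul_inv_cancel₀ hL.ne', one_smul]⟩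
  obtain ⟨b, rfl⟩ : ∃ b', b = L • b' := ⟨L⁻¹ • b, by rw [smul_smul, mul_inv_cancel₀ hL.ne', one_smul]⟩
  have key : ∀ t, (4 * L ^ 2) • y t = Real.exp (L * t) • ((c - d) + t • (L • d)) +
      decayCurve L (a + b) (L • b) t := by
    intro t
    obtain ⟨w0, w1⟩ := hw t
    obtain ⟨u0, u1⟩ := hu t
    simp only [Nat.reduceAdd] at w0 w1 u0 u1
    refine smul_right_injective E hL.ne' ?_
    simp only [decayCurve, ← hY0]
    linear_combination (norm := module) L • w0 + L • u0 - w1 + u1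
  obtain ⟨C, hC⟩ := exists_norm_decayCurve_le hL (a + b) (L • b)
  obtain ⟨hc, hd⟩ := eq_zero_of_norm_exp_smul_le hL (c := c - d) (d := L • d)
    (K := 4 * L ^ 2 * K + C) fun t ht => by
      rw [← sub_eq_iff_eq_add.2 (key t)]
      refine (norm_sub_le _ _).trans (add_le_add ?_ (hC t ht))
      rw [norm_smul, Real.norm_of_nonneg (by positivity)]
      gcongr
      exact hK t ht
  refine ⟨(4 * L ^ 2)⁻¹ • (a + b), (4 * L ^ 2)⁻¹ • (L • b), funext fun t => ?_⟩
  have h4 : (4 * L ^ 2) ≠ 0 := by positivity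
  have := congrArg (fun x => (4 * L ^ 2)⁻¹ • x) (key t)
  simp only [hc, hd, smul_smul, inv_mul_cancel₀ h4, one_smul, smul_zero, add_zero, zero_add] at this
  rw [this]
  simp only [decayCurve]
  module

end ODE

/-! ### Complexification -/

section Complexify

variable {V W U : Type*} [NormedAddCommGroup V] [NormedSpace ℝ V]
  [NormedAddCommGroup W] [NormedSpace ℝ W] [NormedAddCommGroup U] [NormedSpace ℝ U] {p q r : ℕ}

/-- The real part of a complex alternating form. -/
def rePart (y : V [⋀^Fin p]→L[ℝ] ℂ) : V [⋀^Fin p]→L[ℝ] ℝ :=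
  Complex.reCLM.compContinuousAlternatingMap y

/-- The imaginary part of a complex alternating form. -/
def imPart (y : V [⋀^Fin p]→L[ℝ] ℂ) : V [⋀^Fin p]→L[ℝ] ℝ :=
  Complex.imCLM.compContinuousAlternatingMap y

theorem eq_of_rePart_of_imPart {y z : V [⋀^Fin p]→L[ℝ] ℂ} (hre : rePart y = rePart z)
    (him : imPart y = imPart z) : y = z := by
  ext w
  exact Complex.ext (DFunLike.congr_fun hre w) (DFunLike.congr_fun him w)

theorem rePart_complexify (c : (V [⋀^Fin p]→L[ℝ] ℝ) →ₗ[ℝ] (W [⋀^Fin q]→L[ℝ] ℝ))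
    (y : V [⋀^Fin p]→L[ℝ] ℂ) : rePart (complexify c y) = c (rePart y) := by
  ext w
  simp [rePart, complexify]

theorem imPart_complexify (c : (V [⋀^Fin p]→L[ℝ] ℝ) →ₗ[ℝ] (W [⋀^Fin q]→L[ℝ] ℝ))
    (y : V [⋀^Fin p]→L[ℝ] ℂ) : imPart (complexify c y) = c (imPart y) := by
  ext w
  simp [imPart, complexify]

theorem complexify_comp (c : (W [⋀^Fin q]→L[ℝ] ℝ) →ₗ[ℝ] (U [⋀^Fin r]→L[ℝ] ℝ))
    (d : (V [⋀^Fin p]→L[ℝ] ℝ) →ₗ[ℝ] (W [⋀^Fin q]→L[ℝ] ℝ)) (y : V [⋀^Fin p]→L[ℝ] ℂ) :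
    complexify (c ∘ₗ d) y = complexify c (complexify d y) := by
  refine eq_of_rePart_of_imPart ?_ ?_
  · simp [rePart_complexify]
  · simp [imPart_complexify]

theorem complexify_id (y : V [⋀^Fin p]→L[ℝ] ℂ) : complexify LinearMap.id y = y :=
  eq_of_rePart_of_imPart (rePart_complexify _ _) (imPart_complexify _ _)

theorem complexify_smul (a : ℝ) (c : (V [⋀^Fin p]→L[ℝ] ℝ) →ₗ[ℝ] (W [⋀^Fin q]→L[ℝ] ℝ))
    (y : V [⋀^Fin p]→L[ℝ] ℂ) : complexify (a • c) y = (a : ℂ) • complexify c y := by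
  refine eq_of_rePart_of_imPart ?_ ?_
  · rw [rePart_complexify]
    have h : rePart ((a : ℂ) • complexify c y) = a • rePart (complexify c y) := by
      ext w; simp [rePart]
    rw [h, rePart_complexify]; rfl
  · rw [imPart_complexify]
    have h : imPart ((a : ℂ) • complexify c y) = a • imPart (complexify c y) := by
      ext w; simp [imPart]
    rw [h, imPart_complexify]; rfl

theorem complexify_neg (c : (V [⋀^Fin p]→L[ℝ] ℝ) →ₗ[ℝ] (W [⋀^Fin q]→L[ℝ] ℝ))
    (y : V [⋀^Fin p]→L[ℝ] ℂ) : complexify (-c) y = -complexify c y := by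
  refine eq_of_rePart_of_imPart ?_ ?_
  · rw [rePart_complexify]
    exact congrArg Neg.neg (rePart_complexify c y).symm |>.trans (by ext w; simp [rePart])
  · rw [imPart_complexify]
    exact congrArg Neg.neg (imPart_complexify c y).symm |>.trans (by ext w; simp [imPart])

theorem complexify_zero (y : V [⋀^Fin p]→L[ℝ] ℂ) :
    complexify (0 : (V [⋀^Fin p]→L[ℝ] ℝ) →ₗ[ℝ] (W [⋀^Fin q]→L[ℝ] ℝ)) y = 0 := by
  refine eq_of_rePart_of_imPart ?_ ?_
  · rw [rePart_complexify]; ext w; simp [rePart]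
  · rw [imPart_complexify]; ext w; simp [imPart]

theorem complexify_eq_zero_iff (c : (V [⋀^Fin p]→L[ℝ] ℝ) →ₗ[ℝ] (W [⋀^Fin q]→L[ℝ] ℝ))
    (y : V [⋀^Fin p]→L[ℝ] ℂ) :
    complexify c y = 0 ↔ c (rePart y) = 0 ∧ c (imPart y) = 0 := by
  rw [← rePart_complexify, ← imPart_complexify]
  refine ⟨fun h => ?_, fun h => ?_⟩
  · rw [h]
    exact ⟨by ext; simp [rePart], by ext; simp [imPart]⟩
  · refine eq_of_rePart_of_imPart (h.1.trans ?_) (h.2.trans ?_)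
    · ext; simp [rePart]
    · ext; simp [imPart]

end Complexify

/-! ### The boundary symbol map of the bi-Laplacian -/

section BoundarySymbolMap

variable {V U : Type*} [NormedAddCommGroup V] [NormedSpace ℝ V]
  [NormedAddCommGroup U] [NormedSpace ℝ U] {p : ℕ}

/-- The coefficients of `(L² s² + t²)²`. -/
def biharmonicCoeff (L : ℝ) : ℕ → ℝ
  | 0 => L ^ 4
  | 2 => 2 * L ^ 2
  | 4 => 1
  | _ => 0

/-- The expansion of the symbol of the bi-Laplacian. -/
def biharmonicExpansion (V : Type*) [NormedAddCommGroup V] [NormedSpace ℝ V] (p : ℕ) (L : ℝ)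
    (j : ℕ) : (V [⋀^Fin p]→L[ℝ] ℝ) →ₗ[ℝ] (V [⋀^Fin p]→L[ℝ] ℝ) :=
  biharmonicCoeff L j • LinearMap.id

theorem symbolOp_biharmonicExpansion (L : ℝ) (y : ℝ → V [⋀^Fin p]→L[ℝ] ℂ) (t : ℝ) :
    symbolOp 4 (biharmonicExpansion V p L) y t =
      L ^ 4 • y t - (2 * L ^ 2) • iteratedDeriv 2 y t + iteratedDeriv 4 y t := by
  ext w
  simp [symbolOp, biharmonicExpansion, complexify_smul, complexify_id, Finset.sum_range_succ,
    biharmonicCoeff, Even.neg_pow (show Even 4 by decide), sub_eq_add_neg]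

/-- The value at `0` of the operator with expansion `b` on the curve `e^{-Lt} (a₀ + t a₁)`. -/
def symbolOnDecay {q : ℕ} (L : ℝ) (r : ℕ)
    (b : ℕ → (V [⋀^Fin p]→L[ℝ] ℝ) →ₗ[ℝ] (U [⋀^Fin q]→L[ℝ] ℝ)) (a₀ a₁ : V [⋀^Fin p]→L[ℝ] ℂ) :
    U [⋀^Fin q]→L[ℝ] ℂ :=
  ∑ j ∈ Finset.range (r + 1), (-Complex.I) ^ (r - j) •
    complexify (b j) (((-L : ℂ) ^ j) • a₀ + (j * (-L : ℂ) ^ (j - 1)) • a₁)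

theorem symbolOp_decayCurve {q : ℕ} (L : ℝ) (r : ℕ)
    (b : ℕ → (V [⋀^Fin p]→L[ℝ] ℝ) →ₗ[ℝ] (U [⋀^Fin q]→L[ℝ] ℝ)) (a₀ a₁ : V [⋀^Fin p]→L[ℝ] ℂ) :
    symbolOp r b (decayCurve L a₀ a₁) 0 = symbolOnDecay L r b a₀ a₁ := by
  refine Finset.sum_congr rfl fun j _ => ?_
  rw [iteratedDeriv_decayCurve, decayCurve_zero]
  congr 2
  ext w
  simp

theorem symbolOp_biharmonicExpansion_decayCurve (L : ℝ) (a b : V [⋀^Fin p]→L[ℝ] ℂ) (t : ℝ) :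
    symbolOp 4 (biharmonicExpansion V p L) (decayCurve L a b) t = 0 := by
  rw [symbolOp_biharmonicExpansion, iteratedDeriv_decayCurve, iteratedDeriv_decayCurve]
  simp only [decayCurve]
  push_cast
  module

theorem bijective_boundarySymbolMap {L : ℝ} (hL : 0 < L) {m : ℕ} {r d : Fin m → ℕ}
    {b : (j : Fin m) → ℕ → (V [⋀^Fin p]→L[ℝ] ℝ) →ₗ[ℝ] (U [⋀^Fin (d j)]→L[ℝ] ℝ)}
    (hinj : ∀ a₀ a₁, (∀ j, symbolOnDecay L (r j) (b j) a₀ a₁ = 0) → a₀ = 0 ∧ a₁ = 0)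
    (hsurj : ∀ z : (j : Fin m) → U [⋀^Fin (d j)]→L[ℝ] ℂ,
      ∃ a₀ a₁, ∀ j, symbolOnDecay L (r j) (b j) a₀ a₁ = z j) :
    Function.Bijective (boundarySymbolMap 4 (biharmonicExpansion V p L) r d b) := by
  refine ⟨(injective_iff_map_eq_zero _).2 fun y hy => ?_, fun z => ?_⟩
  · obtain ⟨y, hys, hyeq, K, hK⟩ := y
    obtain ⟨a₀, a₁, rfl⟩ := exists_eq_decayCurve hL hys
      (fun t => (symbolOp_biharmonicExpansion L y t).symm.trans (hyeq t)) hK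
    obtain ⟨rfl, rfl⟩ := hinj a₀ a₁ fun j => by
      rw [← symbolOp_decayCurve]
      exact congrFun hy j
    refine Subtype.ext (funext fun t => ?_)
    simp [decayCurve]
  · obtain ⟨a₀, a₁, h⟩ := hsurj z
    refine ⟨⟨decayCurve L a₀ a₁, contDiff_decayCurve L a₀ a₁,
      symbolOp_biharmonicExpansion_decayCurve L a₀ a₁, exists_norm_decayCurve_le hL a₀ a₁⟩,
      funext fun j => ?_⟩
    rw [← h j, ← symbolOp_decayCurve]
    rfl

end BoundarySymbolMap

/-! ### Tangential and normal parts -/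

section Parts

variable {V U : Type*} [NormedAddCommGroup V] [NormedSpace ℝ V]
  [NormedAddCommGroup U] [NormedSpace ℝ U] {p : ℕ}

/-- The pullback of alternating forms by a linear map. -/
def pullback (A : U →L[ℝ] V) : (V [⋀^Fin p]→L[ℝ] ℝ) →ₗ[ℝ] (U [⋀^Fin p]→L[ℝ] ℝ) where
  toFun u := u.compContinuousLinearMap A
  map_add' _ _ := rfl
  map_smul' _ _ := rfl

theorem pullback_apply (A : U →L[ℝ] V) (u : V [⋀^Fin p]→L[ℝ] ℝ) (w : Fin p → U) :
    pullback A u w = u (A ∘ w) := rfl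

theorem pullback_wedge (A : U →L[ℝ] V) (ξ : V →L[ℝ] ℝ) (u : V [⋀^Fin p]→L[ℝ] ℝ) :
    pullback A (wedge ξ u) = wedge (ξ.comp A) (pullback A u) := by
  ext w
  rw [pullback_apply, wedge_apply, wedge_apply]
  rfl

theorem pullback_interiorMul (A : U →L[ℝ] V) (a : U) (u : V [⋀^Fin (p + 1)]→L[ℝ] ℝ) :
    pullback A (interiorMul (A a) u) = interiorMul a (pullback A u) := by
  ext w
  rw [pullback_apply, interiorMul_apply, interiorMul_apply, pullback_apply]
  congr 1
  funext i
  refine Fin.cases rfl (fun i => rfl) i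

theorem update_eq_zero_of_interiorMul_eq_zero {ν : V} {u : V [⋀^Fin (p + 1)]→L[ℝ] ℝ}
    (h : interiorMul ν u = 0) (w : Fin (p + 1) → V) (i : Fin (p + 1)) :
    u (Function.update w i ν) = 0 := by
  rw [← Fin.insertNth_removeNth, ContinuousAlternatingMap.map_insertNth]
  have : u (Fin.cons ν (i.removeNth w)) = 0 := DFunLike.congr_fun h _
  rw [show (Matrix.vecCons ν (i.removeNth w) : Fin (p + 1) → V) = Fin.cons ν (i.removeNth w)
    from rfl, this, smul_zero]

theorem apply_eq_of_interiorMul_eq_zero {ν : V} {u : V [⋀^Fin (p + 1)]→L[ℝ] ℝ}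
    (h : interiorMul ν u = 0) (c : Fin (p + 1) → ℝ) (w : Fin (p + 1) → V) :
    u w = u fun i => w i - c i • ν := by
  have key : ∀ s : Finset (Fin (p + 1)), u (s.piecewise (fun i => w i - c i • ν) w) = u w := by
    intro s
    induction s using Finset.induction_on with
    | empty => simp
    | insert i s hi ih =>
      rw [Finset.piecewise_insert, sub_eq_add_neg, ← neg_smul,
        ContinuousAlternatingMap.map_update_add, ContinuousAlternatingMap.map_update_smul,
        update_eq_zero_of_interiorMul_eq_zero h, smul_zero, add_zero]
      rw [show w i = s.piecewise (fun i => w i - c i • ν) w i by simp [hi],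
        Function.update_eq_self, ih]
  rw [← key Finset.univ, Finset.piecewise_univ]

end Parts

/-! ### The linear systems for the coefficients of a bounded solution -/

section LinearSystem

variable {X Y Z : Type*} [AddCommGroup X] [Module ℂ X] [AddCommGroup Y] [Module ℂ Y]
  [AddCommGroup Z] [Module ℂ Z] {T : X →ₗ[ℂ] Y} {N : X →ₗ[ℂ] Z} {W : Z →ₗ[ℂ] Y} {J : Y →ₗ[ℂ] Z}
  {L : ℂ}

theorem injective_neumannSystem (hL : L ≠ 0) (hker : ∀ x, T x = 0 → N x = 0 → x = 0) {a b : X}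
    (h0 : N a = 0) (h1 : Complex.I • W (N a) + T b - L • T a = 0) (h2 : (2 * L) • N b = 0)
    (h3 : (2 * Complex.I * L) • W (N b) - (2 * L ^ 2) • T b = 0) : a = 0 ∧ b = 0 := by
  have hNb : N b = 0 := (smul_eq_zero.1 h2).resolve_left (by simpa using hL)
  have hTb : T b = 0 := by
    rw [hNb, map_zero, smul_zero, zero_sub, neg_eq_zero] at h3
    exact (smul_eq_zero.1 h3).resolve_left (by simpa using hL)
  have hTa : T a = 0 := by
    rw [h0, hTb, map_zero, smul_zero, zero_add, zero_sub, neg_eq_zero] at h1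
    exact (smul_eq_zero.1 h1).resolve_left hL
  exact ⟨hker a hTa h0, hker b hTb hNb⟩

theorem surjective_neumannSystem (hL : L ≠ 0) (hsurj : ∀ y z, ∃ x, T x = y ∧ N x = z)
    (z0 : Z) (z1 : Y) (z2 : Z) (z3 : Y) :
    ∃ a b, N a = z0 ∧ Complex.I • W (N a) + T b - L • T a = z1 ∧ (2 * L) • N b = z2 ∧
      (2 * Complex.I * L) • W (N b) - (2 * L ^ 2) • T b = z3 := by
  obtain ⟨b, hTb, hNb⟩ := hsurj
    ((2 * L ^ 2)⁻¹ • ((2 * Complex.I * L) • W ((2 * L)⁻¹ • z2) - z3)) ((2 * L)⁻¹ • z2)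
  obtain ⟨a, hTa, hNa⟩ := hsurj (L⁻¹ • (Complex.I • W z0 + T b - z1)) z0
  refine ⟨a, b, hNa, ?_, ?_, ?_⟩
  · rw [hTa, hNa, smul_smul, mul_inv_cancel₀ hL, one_smul]; abel
  · rw [hNb, smul_smul, mul_inv_cancel₀ (by simpa using hL), one_smul]
  · rw [hNb, hTb, smul_smul (2 * L ^ 2), mul_inv_cancel₀ (by simpa using hL), one_smul]; abel

theorem injective_codiffSystem (hL : L ≠ 0) (hker : ∀ x, T x = 0 → N x = 0 → x = 0)
    (hJ : ∀ y, J (W (J y)) = L ^ 2 • J y) {a b : X} (h0 : N a = 0)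
    (h1 : Complex.I • W (N a) + T b - L • T a = 0)
    (h2 : Complex.I • J (T a) - N b + L • N a = 0)
    (h3 : (2 * Complex.I * L) • W (N b) - (2 * L ^ 2) • T b = 0) : a = 0 ∧ b = 0 := by
  have hTb : T b = L • T a := by
    rw [h0, map_zero, smul_zero, zero_add] at h1
    exact sub_eq_zero.1 h1
  have hNb : N b = Complex.I • J (T a) := by
    rw [h0, smul_zero, add_zero] at h2
    exact (sub_eq_zero.1 h2).symm
  have h4 : (-2 * L) • (W (J (T a)) + L ^ 2 • T a) = 0 := by
    rw [← h3, hTb, hNb, map_smul, smul_smul,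
      show 2 * Complex.I * L * Complex.I = -2 * L by linear_combination (2 * L) * Complex.I_sq]
    module
  have h5 : W (J (T a)) + L ^ 2 • T a = 0 := (smul_eq_zero.1 h4).resolve_left (by simpa using hL)
  have hJT : J (T a) = 0 := by
    have h6 := congrArg J h5
    rw [map_add, map_smul, hJ, map_zero, ← two_smul ℂ, smul_smul] at h6
    exact (smul_eq_zero.1 h6).resolve_left (by simpa using hL)
  have hTa : T a = 0 := by
    rw [hJT, map_zero, zero_add] at h5
    exact (smul_eq_zero.1 h5).resolve_left (by simpa using hL)
  refine ⟨hker a hTa h0, hker b ?_ ?_⟩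
  · rw [hTb, hTa, smul_zero]
  · rw [hNb, hJT, smul_zero]

theorem surjective_codiffSystem (hL : L ≠ 0) (hsurj : ∀ y z, ∃ x, T x = y ∧ N x = z)
    (hJ : ∀ y, J (W (J y)) = L ^ 2 • J y) (z0 : Z) (z1 : Y) (z2 : Z) (z3 : Y) :
    ∃ a b, N a = z0 ∧ Complex.I • W (N a) + T b - L • T a = z1 ∧
      Complex.I • J (T a) - N b + L • N a = z2 ∧
      (2 * Complex.I * L) • W (N b) - (2 * L ^ 2) • T b = z3 := by
  obtain ⟨q, hq⟩ : ∃ q, (-2 * L) • q = z3 - (2 * Complex.I * L) • W (L • z0 - z2) +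
      (2 * L ^ 2) • (z1 - Complex.I • W z0) :=
    ⟨(-2 * L)⁻¹ • _, by rw [smul_smul, mul_inv_cancel₀ (by simpa using hL), one_smul]⟩
  obtain ⟨y, hy⟩ : ∃ y, W (J y) + L ^ 2 • y = q := by
    refine ⟨(L ^ 2)⁻¹ • (q - (2 * L ^ 2)⁻¹ • W (J q)), ?_⟩
    have h1 : (L ^ 2) * (L ^ 2)⁻¹ = 1 := mul_inv_cancel₀ (by simpa using hL)
    have h2 : J ((L ^ 2)⁻¹ • (q - (2 * L ^ 2)⁻¹ • W (J q))) = (2 * L ^ 2)⁻¹ • J q := by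
      simp only [map_smul, map_sub, hJ, smul_smul]
      rw [show (2 * L ^ 2)⁻¹ * L ^ 2 = (2 : ℂ)⁻¹ by field_simp, mul_inv]
      module
    rw [h2, map_smul, smul_smul, h1, one_smul]
    abel
  obtain ⟨a, hTa, hNa⟩ := hsurj y z0
  obtain ⟨b, hTb, hNb⟩ := hsurj (z1 - Complex.I • W z0 + L • y) (Complex.I • J y - z2 + L • z0)
  refine ⟨a, b, hNa, ?_, ?_, ?_⟩
  · rw [hNa, hTa, hTb]; abel
  · rw [hTa, hNa, hNb]; abel
  · rw [hNb, hTb]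
    have h3 : W (Complex.I • J y - z2 + L • z0) = Complex.I • W (J y) + W (L • z0 - z2) := by
      simp only [map_add, map_sub, map_smul]; abel
    have h4 : (2 * Complex.I * L) • Complex.I • W (J y) = (-2 * L) • W (J y) := by
      rw [smul_smul]
      congr 1
      linear_combination (2 * L) * Complex.I_sq
    rw [h3, smul_add, h4, smul_add (2 * L ^ 2)]
    rw [← hy] at hq
    linear_combination (norm := module) hq

theorem injective_functionSystem (hL : L ≠ 0) (hker : ∀ x, T x = 0 → x = 0) {a b : X}
    (h1 : T b - L • T a = 0) (h3 : -(2 * L ^ 2) • T b = 0) : a = 0 ∧ b = 0 := by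
  have hTb : T b = 0 := (smul_eq_zero.1 h3).resolve_left (by simpa using hL)
  rw [hTb, zero_sub, neg_eq_zero] at h1
  exact ⟨hker a ((smul_eq_zero.1 h1).resolve_left hL), hker b hTb⟩

theorem surjective_functionSystem (hL : L ≠ 0) (hsurj : ∀ y, ∃ x, T x = y) (z1 z3 : Y) :
    ∃ a b, T b - L • T a = z1 ∧ -(2 * L ^ 2) • T b = z3 := by
  obtain ⟨b, hTb⟩ := hsurj ((-(2 * L ^ 2))⁻¹ • z3)
  obtain ⟨a, hTa⟩ := hsurj (L⁻¹ • (T b - z1))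
  refine ⟨a, b, ?_, ?_⟩
  · rw [hTa, smul_smul, mul_inv_cancel₀ hL, one_smul]; abel
  · rw [hTb, smul_smul, mul_inv_cancel₀ (by simpa using hL), one_smul]

end LinearSystem

/-! ### Geometry at a boundary point -/

section BoundaryPoint

variable {n p : ℕ} [NeZero n] {G : Bilin n}

/-- The unit normal of the hyperplane `bdryTangent n` for the scalar product `G`. -/
def unitNormal (G : Bilin n) : Model n :=
  (√ (coordCovec 0 (sharp G (coordCovec 0))))⁻¹ • sharp G (coordCovec 0)

theorem normSq_pos (pos : ∀ a, a ≠ 0 → 0 < G a a) {ξ : Model n →L[ℝ] ℝ} (hξ : ξ ≠ 0) :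
    0 < normSq G ξ := by
  have h : sharp G ξ ≠ 0 := fun h0 => hξ (by rw [← flat_sharp pos ξ, h0, map_zero])
  have := pos _ h
  rwa [flat_sharp pos] at this

theorem normSq_coordCovec_pos (pos : ∀ a, a ≠ 0 → 0 < G a a) :
    0 < coordCovec (0 : Fin n) (sharp G (coordCovec 0)) :=
  normSq_pos pos fun h => by
    have := DFunLike.congr_fun h (coordVec (0 : Fin n))
    simp [coordCovec, coordVec] at this

theorem flat_unitNormal (pos : ∀ a, a ≠ 0 → 0 < G a a) :
    G (unitNormal G) = (√ (coordCovec 0 (sharp G (coordCovec 0))))⁻¹ • coordCovec (0 : Fin n) := by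
  rw [unitNormal, map_smul, flat_sharp pos]

theorem flat_unitNormal_self (pos : ∀ a, a ≠ 0 → 0 < G a a) :
    G (unitNormal G) (unitNormal G) = 1 := by
  have h := normSq_coordCovec_pos pos
  rw [flat_unitNormal pos, unitNormal, map_smul, smul_apply, smul_eq_mul, smul_eq_mul, ← mul_assoc,
    ← mul_inv, Real.mul_self_sqrt h.le, inv_mul_cancel₀ h.ne']

theorem mem_bdryTangent_iff (pos : ∀ a, a ≠ 0 → 0 < G a a) (a : Model n) :
    a ∈ bdryTangent n ↔ G (unitNormal G) a = 0 := by
  have h := (Real.sqrt_pos.2 (normSq_coordCovec_pos pos)).ne'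
  rw [flat_unitNormal pos, smul_apply, smul_eq_mul, mul_eq_zero, or_iff_right (inv_ne_zero h)]
  rfl

theorem normSq_smul_add_smul (symm : ∀ a b, G a b = G b a) (pos : ∀ a, a ≠ 0 → 0 < G a a)
    {v : Model n →L[ℝ] ℝ} (hv : v (unitNormal G) = 0) (s t : ℝ) :
    normSq G (s • v + t • G (unitNormal G)) = s ^ 2 * normSq G v + t ^ 2 := by
  have h : G (unitNormal G) (sharp G v) = 0 := by rw [symm, flat_sharp pos, hv]
  simp only [normSq, map_add, map_smul, sharp_flat pos, add_apply, smul_apply, smul_eq_mul, hv, h,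
    flat_unitNormal_self pos]
  ring

theorem sharp_mem_bdryTangent (symm : ∀ a b, G a b = G b a) (pos : ∀ a, a ≠ 0 → 0 < G a a)
    {v : Model n →L[ℝ] ℝ} (hv : v (unitNormal G) = 0) : sharp G v ∈ bdryTangent n := by
  rw [mem_bdryTangent_iff pos, symm, flat_sharp pos, hv]

/-- The orthogonal projection onto `bdryTangent n`. -/
def tangentProj (pos : ∀ a, a ≠ 0 → 0 < G a a) : Model n →L[ℝ] bdryTangent n :=
  (ContinuousLinearMap.id ℝ (Model n) - (G (unitNormal G)).smulRight (unitNormal G)).codRestrict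
    (bdryTangent n) fun a => by
      rw [mem_bdryTangent_iff pos]
      simp [flat_unitNormal_self pos]

theorem coe_tangentProj (pos : ∀ a, a ≠ 0 → 0 < G a a) (a : Model n) :
    (tangentProj pos a : Model n) = a - G (unitNormal G) a • unitNormal G := rfl

theorem tangentProj_coe (pos : ∀ a, a ≠ 0 → 0 < G a a) (a : bdryTangent n) :
    tangentProj pos a = a := by
  ext1
  rw [coe_tangentProj, (mem_bdryTangent_iff pos a).1 a.2, zero_smul, sub_zero]

theorem tangentProj_unitNormal (pos : ∀ a, a ≠ 0 → 0 < G a a) :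
    tangentProj pos (unitNormal G) = 0 := by
  ext1
  rw [coe_tangentProj, flat_unitNormal_self pos, one_smul, sub_self]
  rfl

theorem restrictL_pullback_tangentProj (pos : ∀ a, a ≠ 0 → 0 < G a a) (y : BdryAlt n p) :
    restrictL (pullback (tangentProj pos) y) = y := by
  ext w
  change y (tangentProj pos ∘ Subtype.val ∘ w) = y w
  congr 1
  funext i
  exact tangentProj_coe pos (w i)

theorem interiorMul_pullback_tangentProj (pos : ∀ a, a ≠ 0 → 0 < G a a) (y : BdryAlt n (p + 1)) :
    interiorMul (unitNormal G) (pullback (tangentProj pos) y) = 0 := by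
  ext w
  change y (tangentProj pos ∘ Fin.cons (unitNormal G) w) = 0
  exact y.map_coord_zero 0 (tangentProj_unitNormal pos)

theorem contractL_wedge_flat (pos : ∀ a, a ≠ 0 → 0 < G a a) (u : Alt n p) :
    contractL (unitNormal G) (wedge (G (unitNormal G)) u) = restrictL u := by
  have h0 : (G (unitNormal G)).comp (bdryTangent n).subtypeL = 0 := by
    ext a
    exact (mem_bdryTangent_iff pos a).1 a.2
  rw [contractL, LinearMap.comp_apply]
  cases p with
  | zero => rw [interiorMul_wedge_zero, flat_unitNormal_self pos, one_smul]
  | succ p =>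
    rw [interiorMul_wedge, flat_unitNormal_self pos, one_smul, map_sub]
    have : restrictL (wedge (G (unitNormal G)) (interiorMul (unitNormal G) u)) = 0 := by
      refine (pullback_wedge (bdryTangent n).subtypeL _ _).trans ?_
      rw [h0, ← zero_smul ℝ (0 : bdryTangent n →L[ℝ] ℝ), wedge_smul_left, zero_smul]
      rfl
    rw [this, sub_zero]

theorem restrictL_wedge_flat (pos : ∀ a, a ≠ 0 → 0 < G a a) (u : Alt n p) :
    restrictL (wedge (G (unitNormal G)) u) = 0 := by
  have h0 : (G (unitNormal G)).comp (bdryTangent n).subtypeL = 0 := by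
    ext a
    exact (mem_bdryTangent_iff pos a).1 a.2
  refine (pullback_wedge (bdryTangent n).subtypeL _ _).trans ?_
  rw [h0, ← zero_smul ℝ (0 : bdryTangent n →L[ℝ] ℝ), wedge_smul_left, zero_smul]
  rfl

theorem contractL_wedge_zero {v : Model n →L[ℝ] ℝ} (hv : v (unitNormal G) = 0) :
    contractL (unitNormal G) ∘ₗ wedge (p := 0) v = 0 := by
  refine LinearMap.ext fun u => ?_
  rw [contractL, LinearMap.comp_apply, LinearMap.comp_apply, interiorMul_wedge_zero, hv, zero_smul,
    map_zero]
  rfl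

theorem contractL_wedge {v : Model n →L[ℝ] ℝ} (hv : v (unitNormal G) = 0) :
    contractL (unitNormal G) ∘ₗ wedge (p := p + 1) v =
      -(wedge (v.comp (bdryTangent n).subtypeL) ∘ₗ contractL (unitNormal G)) := by
  refine LinearMap.ext fun u => ?_
  rw [contractL, LinearMap.comp_apply, LinearMap.comp_apply, interiorMul_wedge, hv, zero_smul,
    zero_sub, map_neg]
  exact congrArg Neg.neg (pullback_wedge (bdryTangent n).subtypeL _ _)

theorem eq_zero_of_restrictL_of_contractL (pos : ∀ a, a ≠ 0 → 0 < G a a) {u : Alt n (p + 1)}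
    (hT : restrictL u = 0) (hN : contractL (unitNormal G) u = 0) : u = 0 := by
  have aux : ∀ {q : ℕ} {u : Alt n (q + 1)}, restrictL u = 0 → interiorMul (unitNormal G) u = 0 →
      u = 0 := by
    intro q u hT hN
    ext w
    rw [apply_eq_of_interiorMul_eq_zero hN (fun i => G (unitNormal G) (w i)) w]
    exact DFunLike.congr_fun hT fun i => tangentProj pos (w i)
  refine aux hT ?_
  cases p with
  | zero =>
    ext w
    rw [Subsingleton.elim w (Subtype.val ∘ fun i : Fin 0 => (i.elim0 : bdryTangent n))]
    exact DFunLike.congr_fun hN _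
  | succ p => exact aux hN (interiorMul_interiorMul_self _ _)

theorem eq_zero_of_restrictL {u : Alt n 0} (hT : restrictL u = 0) : u = 0 := by
  ext w
  rw [Subsingleton.elim w (Subtype.val ∘ fun i : Fin 0 => (i.elim0 : bdryTangent n))]
  exact DFunLike.congr_fun hT _

theorem interiorMul_wedge_interiorMul {V : Type*} [NormedAddCommGroup V] [NormedSpace ℝ V]
    (a : V) (ξ : V →L[ℝ] ℝ) (u : V [⋀^Fin (p + 1)]→L[ℝ] ℝ) :
    interiorMul a (wedge ξ (interiorMul a u)) = ξ a • interiorMul a u := by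
  cases p with
  | zero => rw [interiorMul_wedge_zero]
  | succ p => rw [interiorMul_wedge, interiorMul_interiorMul_self, map_zero, sub_zero]

/-! The complexified versions. -/

theorem exists_complexify_restrictL_eq (pos : ∀ a, a ≠ 0 → 0 < G a a)
    (y : bdryTangent n [⋀^Fin p]→L[ℝ] ℂ) : ∃ x, complexify (restrictL (n := n)) x = y := by
  refine ⟨complexify (pullback (tangentProj pos)) y, ?_⟩
  rw [← complexify_comp, show restrictL ∘ₗ pullback (tangentProj pos) = LinearMap.id from
    LinearMap.ext (restrictL_pullback_tangentProj pos), complexify_id]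

theorem exists_complexify_parts_eq (pos : ∀ a, a ≠ 0 → 0 < G a a)
    (y : bdryTangent n [⋀^Fin (p + 1)]→L[ℝ] ℂ) (z : bdryTangent n [⋀^Fin p]→L[ℝ] ℂ) :
    ∃ x, complexify (restrictL (n := n)) x = y ∧
      complexify (contractL (unitNormal G)) x = z := by
  refine ⟨complexify (pullback (tangentProj pos)) y +
    complexify (wedge (G (unitNormal G)) ∘ₗ pullback (tangentProj pos)) z, ?_, ?_⟩
  · rw [map_add, ← complexify_comp, ← complexify_comp,
      show restrictL ∘ₗ pullback (tangentProj pos) = LinearMap.id from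
        LinearMap.ext (restrictL_pullback_tangentProj pos), complexify_id,
      show restrictL ∘ₗ wedge (G (unitNormal G)) ∘ₗ pullback (tangentProj pos) = 0 from
        LinearMap.ext fun u => restrictL_wedge_flat pos _, complexify_zero, add_zero]
  · rw [map_add, ← complexify_comp, ← complexify_comp,
      show contractL (unitNormal G) ∘ₗ pullback (tangentProj pos) = 0 from
        LinearMap.ext fun u => (congrArg restrictL
          (interiorMul_pullback_tangentProj pos u)).trans (map_zero _), complexify_zero, zero_add,
      show contractL (unitNormal G) ∘ₗ wedge (G (unitNormal G)) ∘ₗ pullback (tangentProj pos) =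
        LinearMap.id from LinearMap.ext fun u => (contractL_wedge_flat pos _).trans
          (restrictL_pullback_tangentProj pos u), complexify_id]

theorem eq_zero_of_complexify_restrictL {x : Model n [⋀^Fin 0]→L[ℝ] ℂ}
    (hT : complexify (restrictL (n := n)) x = 0) : x = 0 := by
  rw [complexify_eq_zero_iff] at hT
  refine eq_of_rePart_of_imPart ?_ ?_
  · rw [eq_zero_of_restrictL hT.1]; ext; simp [rePart]
  · rw [eq_zero_of_restrictL hT.2]; ext; simp [imPart]

theorem eq_zero_of_complexify_parts (pos : ∀ a, a ≠ 0 → 0 < G a a)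
    {x : Model n [⋀^Fin (p + 1)]→L[ℝ] ℂ} (hT : complexify (restrictL (n := n)) x = 0)
    (hN : complexify (contractL (unitNormal G)) x = 0) : x = 0 := by
  rw [complexify_eq_zero_iff] at hT hN
  refine eq_of_rePart_of_imPart ?_ ?_
  · rw [eq_zero_of_restrictL_of_contractL pos hT.1 hN.1]; ext; simp [rePart]
  · rw [eq_zero_of_restrictL_of_contractL pos hT.2 hN.2]; ext; simp [imPart]

end BoundaryPoint

/-! ### The boundary symbols along decaying solutions -/

section BoundarySymbols

variable {n p : ℕ} [NeZero n]

/-- The restriction, complexified. -/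
def tanC (n p : ℕ) [NeZero n] :
    (Model n [⋀^Fin p]→L[ℝ] ℂ) →ₗ[ℂ] (bdryTangent n [⋀^Fin p]→L[ℝ] ℂ) :=
  complexify restrictL

/-- The contraction with the normal, complexified. -/
def norC (G : Bilin n) (p : ℕ) :
    (Model n [⋀^Fin (p + 1)]→L[ℝ] ℂ) →ₗ[ℂ] (bdryTangent n [⋀^Fin p]→L[ℝ] ℂ) :=
  complexify (contractL (unitNormal G))

/-- The symbol `ν ⌟ (v ∧ ·)`, complexified. -/
def conC (G : Bilin n) (v : Model n →L[ℝ] ℝ) (p : ℕ) :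
    (Model n [⋀^Fin p]→L[ℝ] ℂ) →ₗ[ℂ] (bdryTangent n [⋀^Fin p]→L[ℝ] ℂ) :=
  complexify (contractL (unitNormal G) ∘ₗ wedge v)

/-- The expansion of the symbol of `η ↦ ν ⌟ η`. -/
def expNormal (G : Bilin n) (p : ℕ) : ℕ → Alt n (p + 1) →ₗ[ℝ] BdryAlt n p :=
  fun _ => contractL (unitNormal G)

/-- The expansion of the symbol of `η ↦ ν ⌟ dη`. -/
def expNormalD (G : Bilin n) (v : Model n →L[ℝ] ℝ) (p : ℕ) : ℕ → Alt n p →ₗ[ℝ] BdryAlt n p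
  | 0 => contractL (unitNormal G) ∘ₗ wedge v
  | _ => restrictL

/-- The expansion of the symbol of `η ↦ ν ⌟ Δη`. -/
def expNormalLap (G : Bilin n) (v : Model n →L[ℝ] ℝ) (p : ℕ) :
    ℕ → Alt n (p + 1) →ₗ[ℝ] BdryAlt n p
  | 0 => -normSq G v • contractL (unitNormal G)
  | 1 => 0
  | _ => -contractL (unitNormal G)

/-- The expansion of the symbol of `η ↦ ι*δη`. -/
def expCodiff (G : Bilin n) (v : Model n →L[ℝ] ℝ) (p : ℕ) :
    ℕ → Alt n (p + 1) →ₗ[ℝ] BdryAlt n p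
  | 0 => -(restrictL ∘ₗ interiorMul (sharp G v))
  | _ => -contractL (unitNormal G)

/-- The expansion of the symbol of `η ↦ ν ⌟ Δdη`. -/
def expNormalLapD (G : Bilin n) (v : Model n →L[ℝ] ℝ) (p : ℕ) : ℕ → Alt n p →ₗ[ℝ] BdryAlt n p
  | 0 => -normSq G v • (contractL (unitNormal G) ∘ₗ wedge v)
  | 1 => -normSq G v • restrictL
  | 2 => -(contractL (unitNormal G) ∘ₗ wedge v)
  | _ => -restrictL

theorem symbolOnDecay_expNormal (G : Bilin n) (L : ℝ) (a b : Model n [⋀^Fin (p + 1)]→L[ℝ] ℂ) :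
    symbolOnDecay L 0 (expNormal G p) a b = norC G p a := by
  simp only [symbolOnDecay, Finset.sum_range_succ, Finset.sum_range_zero, expNormal, norC, map_add,
    map_smul]
  ext w
  simp

theorem symbolOnDecay_expNormalD (G : Bilin n) (v : Model n →L[ℝ] ℝ) (L : ℝ)
    (a b : Model n [⋀^Fin p]→L[ℝ] ℂ) :
    symbolOnDecay L 1 (expNormalD G v p) a b =
      -(Complex.I • conC G v p a) + tanC n p b - (L : ℂ) • tanC n p a := by
  simp only [symbolOnDecay, Finset.sum_range_succ, Finset.sum_range_zero, expNormalD, conC, tanC,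
    map_add, map_smul]
  ext w
  simp
  ring

theorem symbolOnDecay_expNormalLap (G : Bilin n) (v : Model n →L[ℝ] ℝ) {L : ℝ}
    (hL : L ^ 2 = normSq G v) (a b : Model n [⋀^Fin (p + 1)]→L[ℝ] ℂ) :
    symbolOnDecay L 2 (expNormalLap G v p) a b = (2 * L : ℂ) • norC G p b := by
  simp only [symbolOnDecay, Finset.sum_range_succ, Finset.sum_range_zero, expNormalLap, norC,
    map_add, map_smul, complexify_smul, complexify_neg, complexify_zero, ← hL]
  ext w
  simp

theorem symbolOnDecay_expCodiff {G : Bilin n} (symm : ∀ a b, G a b = G b a)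
    (pos : ∀ a, a ≠ 0 → 0 < G a a) {v : Model n →L[ℝ] ℝ} (hv : v (unitNormal G) = 0) (L : ℝ)
    (a b : Model n [⋀^Fin (p + 1)]→L[ℝ] ℂ) :
    symbolOnDecay L 1 (expCodiff G v p) a b =
      Complex.I • complexify (interiorMul ⟨sharp G v, sharp_mem_bdryTangent symm pos hv⟩)
        (tanC n (p + 1) a) - norC G p b + (L : ℂ) • norC G p a := by
  have h : restrictL ∘ₗ interiorMul (sharp G v) =
      interiorMul ⟨sharp G v, sharp_mem_bdryTangent symm pos hv⟩ ∘ₗ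
        restrictL (n := n) (q := p + 1) :=
    LinearMap.ext fun u => (pullback_interiorMul (bdryTangent n).subtypeL
      ⟨sharp G v, sharp_mem_bdryTangent symm pos hv⟩ u)
  simp only [symbolOnDecay, Finset.sum_range_succ, Finset.sum_range_zero, expCodiff, norC, tanC,
    map_add, map_smul, complexify_neg, h, complexify_comp]
  ext w
  simp
  ring

theorem symbolOnDecay_expNormalLapD (G : Bilin n) (v : Model n →L[ℝ] ℝ) {L : ℝ}
    (hL : L ^ 2 = normSq G v) (a b : Model n [⋀^Fin p]→L[ℝ] ℂ) :
    symbolOnDecay L 3 (expNormalLapD G v p) a b =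
      -((2 * Complex.I * L) • conC G v p b) - (2 * L ^ 2 : ℂ) • tanC n p b := by
  simp only [symbolOnDecay, Finset.sum_range_succ, Finset.sum_range_zero, expNormalLapD, conC, tanC,
    map_add, map_smul, complexify_smul, complexify_neg, ← hL]
  ext w
  simp
  ring_nf
  simp only [Complex.I_pow_three]
  ring

end BoundarySymbols

section Expansions

variable {n p : ℕ} [NeZero n] {G : Bilin n} {v : Model n →L[ℝ] ℝ}

theorem hasExpansion_normal :
    HasExpansion (fun _ => contractL (unitNormal G)) 0 v (G (unitNormal G)) (expNormal G p) := by
  intro s t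
  simp [expNormal]

theorem hasExpansion_normalD (pos : ∀ a, a ≠ 0 → 0 < G a a) :
    HasExpansion (fun ξ => contractL (unitNormal G) ∘ₗ wedge ξ) 1 v (G (unitNormal G))
      (expNormalD G v p) := by
  intro s t
  refine LinearMap.ext fun u => ?_
  simp [expNormalD, Finset.sum_range_succ, wedge_add_left, wedge_smul_left,
    contractL_wedge_flat pos]

theorem hasExpansion_codiff (pos : ∀ a, a ≠ 0 → 0 < G a a) :
    HasExpansion (fun ξ => -(restrictL ∘ₗ interiorMul (sharp G ξ))) 1 v (G (unitNormal G))
      (expCodiff G v p) := by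
  intro s t
  refine LinearMap.ext fun u => ?_
  simp [expCodiff, Finset.sum_range_succ, sharp_flat pos, interiorMul_add_left,
    interiorMul_smul_left, contractL]
  abel

theorem hasExpansion_normalLap (symm : ∀ a b, G a b = G b a) (pos : ∀ a, a ≠ 0 → 0 < G a a)
    (hv : v (unitNormal G) = 0) :
    HasExpansion (fun ξ => -normSq G ξ • contractL (unitNormal G)) 2 v (G (unitNormal G))
      (expNormalLap G v p) := by
  intro s t
  simp only [normSq_smul_add_smul symm pos hv, expNormalLap, Finset.sum_range_succ,
    Finset.sum_range_zero]
  module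

theorem hasExpansion_normalLapD (symm : ∀ a b, G a b = G b a) (pos : ∀ a, a ≠ 0 → 0 < G a a)
    (hv : v (unitNormal G) = 0) :
    HasExpansion (fun ξ => -normSq G ξ • (contractL (unitNormal G) ∘ₗ wedge ξ)) 3 v
      (G (unitNormal G)) (expNormalLapD G v p) := by
  intro s t
  have h := hasExpansion_normalD (p := p) (v := v) pos s t
  simp only [expNormalD, Finset.sum_range_succ, Finset.sum_range_zero] at h
  simp only [normSq_smul_add_smul symm pos hv, h, expNormalLapD, Finset.sum_range_succ,
    Finset.sum_range_zero]
  module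

end Expansions

section SymbolData

variable {n p : ℕ} [NeZero n] {M : Type*} [TopologicalSpace M]
  [ChartedSpace (EuclideanHalfSpace n) M] [IsManifold (𝓡∂ n) ∞ M]

/-- The principal symbol of a boundary operator, with its expansions at the covectors
`s v + t ν^♭`. -/
structure SymbolData (g : Metric n M) (B : BoundaryOperator n M p) where
  /-- The principal symbol. -/
  symbol : (𝓡∂ n).boundary M → (Model n →L[ℝ] ℝ) → Alt n p →ₗ[ℝ] BdryAlt n B.deg
  /-- The expansion of the symbol. -/
  expansion : Bilin n → (Model n →L[ℝ] ℝ) → ℕ → Alt n p →ₗ[ℝ] BdryAlt n B.deg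
  hasSymbol : ∀ x, HasPrincipalSymbolAt Subtype.val B.toFun B.order x (symbol x)
  hasExpansion : ∀ x v, v (normal g x.1) = 0 → HasExpansion (symbol x) B.order v
    (metricAt g x.1 (normal g x.1)) (expansion (metricAt g x.1) v)

variable (g : Metric n M)

/-- The symbol of `η ↦ ν ⌟ η`. -/
def symbolDataNormal (p : ℕ) : SymbolData g (opNormal (p := p) g) where
  symbol x _ := contractL (normal g x.1)
  expansion G _ := expNormal G p
  hasSymbol x := hasPrincipalSymbolAt_opNormal g x
  hasExpansion _ _ _ := hasExpansion_normal

/-- The symbol of `η ↦ ν ⌟ dη`. -/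
def symbolDataNormalD (p : ℕ) : SymbolData g (opNormalD (p := p) g) where
  symbol x ξ := contractL (normal g x.1) ∘ₗ wedge ξ
  expansion G v := expNormalD G v p
  hasSymbol x := hasPrincipalSymbolAt_opNormalD g x
  hasExpansion x _ _ := hasExpansion_normalD (metricAt_pos g x.1)

/-- The symbol of `η ↦ ι*δη`. -/
def symbolDataCodiff (p : ℕ) : SymbolData g (opCodiff (p := p) g) where
  symbol x ξ := -(restrictL ∘ₗ interiorMul (sharp (metricAt g x.1) ξ))
  expansion G v := expCodiff G v p
  hasSymbol x := hasPrincipalSymbolAt_opCodiff g x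
  hasExpansion x _ _ := hasExpansion_codiff (metricAt_pos g x.1)

/-- The symbol of `η ↦ ν ⌟ Δη + ℓ ι*δη`. -/
def symbolDataNormalLap (p : ℕ) (l : ℝ) : SymbolData g (opNormalLap (p := p) g l) where
  symbol x ξ := -normSq (metricAt g x.1) ξ • contractL (normal g x.1)
  expansion G v := expNormalLap G v p
  hasSymbol x := hasPrincipalSymbolAt_opNormalLap g x l
  hasExpansion x _ hv :=
    hasExpansion_normalLap (metricAt_symm g x.1) (metricAt_pos g x.1) hv

/-- The symbol of `η ↦ ν ⌟ Δdη + ℓ ι*η`. -/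
def symbolDataNormalLapD (p : ℕ) (l : ℝ) : SymbolData g (opNormalLapD (p := p) g l) where
  symbol x ξ := -normSq (metricAt g x.1) ξ • (contractL (normal g x.1) ∘ₗ wedge ξ)
  expansion G v := expNormalLapD G v p
  hasSymbol x := hasPrincipalSymbolAt_opNormalLapD g x l
  hasExpansion x _ hv :=
    hasExpansion_normalLapD (metricAt_symm g x.1) (metricAt_pos g x.1) hv

end SymbolData

/-! ### Ellipticity -/

section Elliptic

variable {n p : ℕ} [NeZero n] {M : Type*} [TopologicalSpace M]
  [ChartedSpace (EuclideanHalfSpace n) M] [IsManifold (𝓡∂ n) ∞ M]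

theorem hasExpansion_normSq_sq (g : Metric n M) (x : M) {v : Model n →L[ℝ] ℝ}
    (hv : v (normal g x) = 0) :
    HasExpansion (fun ξ => normSq (metricAt g x) ξ ^ 2 • (LinearMap.id : Alt n p →ₗ[ℝ] Alt n p)) 4 v
      (metricAt g x (normal g x)) (biharmonicExpansion (Model n) p √(normSq (metricAt g x) v)) := by
  intro s t
  have h := normSq_smul_add_smul (metricAt_symm g x) (metricAt_pos g x) hv s t
  have h0 : √(normSq (metricAt g x) v) ^ 2 = normSq (metricAt g x) v := by
    refine Real.sq_sqrt ?_
    rcases eq_or_ne v 0 with rfl | h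
    · simp [normSq]
    · exact (normSq_pos (metricAt_pos g x) h).le
  refine (congrArg (fun c : ℝ => c ^ 2 • (LinearMap.id : Alt n p →ₗ[ℝ] Alt n p)) h).trans ?_
  simp only [biharmonicExpansion, biharmonicCoeff, Finset.sum_range_succ, Finset.sum_range_zero,
    show √(normSq (metricAt g x) v) ^ 4 = (√(normSq (metricAt g x) v) ^ 2) ^ 2 by ring, h0]
  module

theorem isElliptic_of_symbolData (g : Metric n M) {m : ℕ} {B : Fin m → BoundaryOperator n M p}
    (D : (j : Fin m) → SymbolData g (B j))
    (hinj : ∀ (G : Bilin n) (v : Model n →L[ℝ] ℝ) (L : ℝ), (∀ a b, G a b = G b a) →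
      (∀ a, a ≠ 0 → 0 < G a a) → v (unitNormal G) = 0 → 0 < L → L ^ 2 = normSq G v → ∀ a b,
      (∀ j, symbolOnDecay L (B j).order ((D j).expansion G v) a b = 0) → a = 0 ∧ b = 0)
    (hsurj : ∀ (G : Bilin n) (v : Model n →L[ℝ] ℝ) (L : ℝ), (∀ a b, G a b = G b a) →
      (∀ a, a ≠ 0 → 0 < G a a) → v (unitNormal G) = 0 → 0 < L → L ^ 2 = normSq G v →
      ∀ z : (j : Fin m) → bdryTangent n [⋀^Fin (B j).deg]→L[ℝ] ℂ,
        ∃ a b, ∀ j, symbolOnDecay L (B j).order ((D j).expansion G v) a b = z j) :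
    BoundaryProblem.IsElliptic ⟨4, biLaplacian g, m, B⟩ g := by
  refine ⟨fun x ξ => normSq (metricAt g x) ξ ^ 2 • LinearMap.id, fun j => (D j).symbol,
    fun x => hasPrincipalSymbolAt_biLaplacian g x, fun j x => (D j).hasSymbol x,
    fun x ξ hξ => ?_, fun x v hv hv0 => ?_⟩
  · have h := (pow_pos (normSq_pos (metricAt_pos g x) hξ) 2).ne'
    exact ⟨fun a b hab => smul_right_injective _ h hab, fun b => ⟨(normSq (metricAt g x) ξ ^ 2)⁻¹ • b,
      smul_inv_smul₀ h b⟩⟩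
  · have hpos := normSq_pos (metricAt_pos g x.1) hv0
    have hL := Real.sqrt_pos.2 hpos
    exact ⟨_, fun j => (D j).expansion (metricAt g x.1) v, hasExpansion_normSq_sq g x.1 hv,
      fun j => (D j).hasExpansion x v hv, bijective_boundarySymbolMap hL
        (hinj _ _ _ (metricAt_symm g x.1) (metricAt_pos g x.1) hv hL (Real.sq_sqrt hpos.le))
        (hsurj _ _ _ (metricAt_symm g x.1) (metricAt_pos g x.1) hv hL (Real.sq_sqrt hpos.le))⟩

theorem isElliptic_functions (g : Metric n M) (l : ℝ) :
    BoundaryProblem.IsElliptic (p := 0)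
      ⟨4, biLaplacian g, 2, ![opNormalD g, opNormalLapD g l]⟩ g := by
  have e1 : ∀ (G : Bilin n) (v : Model n →L[ℝ] ℝ) (L : ℝ), v (unitNormal G) = 0 → ∀ a b,
      symbolOnDecay L 1 (expNormalD G v 0) a b = tanC n 0 b - (L : ℂ) • tanC n 0 a := by
    intro G v L hv a b
    rw [symbolOnDecay_expNormalD, conC, contractL_wedge_zero hv, complexify_zero]
    module
  have e3 : ∀ (G : Bilin n) (v : Model n →L[ℝ] ℝ) (L : ℝ), v (unitNormal G) = 0 →
      L ^ 2 = normSq G v → ∀ a b,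
      symbolOnDecay L 3 (expNormalLapD G v 0) a b = -(2 * L ^ 2 : ℂ) • tanC n 0 b := by
    intro G v L hv hL a b
    rw [symbolOnDecay_expNormalLapD G v hL, conC, contractL_wedge_zero hv, complexify_zero]
    module
  refine isElliptic_of_symbolData g
    (fun | 0 => symbolDataNormalD g 0 | 1 => symbolDataNormalLapD g 0 l) ?_ ?_
  · intro G v L symm pos hv hL hLv a b h
    exact injective_functionSystem (Complex.ofReal_ne_zero.2 hL.ne')
      (fun x => eq_zero_of_complexify_restrictL) ((e1 G v L hv a b).symm.trans (h 0))
      ((e3 G v L hv hLv a b).symm.trans (h 1))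
  · intro G v L symm pos hv hL hLv z
    obtain ⟨a, b, h1, h3⟩ := surjective_functionSystem (Complex.ofReal_ne_zero.2 hL.ne')
      (exists_complexify_restrictL_eq pos) (z 0) (z 1)
    exact ⟨a, b, fun | 0 => (e1 G v L hv a b).trans h1 | 1 => (e3 G v L hv hLv a b).trans h3⟩

/-- The exterior multiplication by the restriction of `v` to the boundary, complexified. -/
def wedgeC (v : Model n →L[ℝ] ℝ) (p : ℕ) :
    (bdryTangent n [⋀^Fin p]→L[ℝ] ℂ) →ₗ[ℂ] (bdryTangent n [⋀^Fin (p + 1)]→L[ℝ] ℂ) :=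
  complexify (wedge (v.comp (bdryTangent n).subtypeL))

theorem conC_succ {G : Bilin n} {v : Model n →L[ℝ] ℝ} (hv : v (unitNormal G) = 0)
    (a : Model n [⋀^Fin (p + 1)]→L[ℝ] ℂ) : conC G v (p + 1) a = -wedgeC v p (norC G p a) := by
  rw [conC, contractL_wedge hv, complexify_neg, complexify_comp]
  rfl

theorem symbolOnDecay_expNormalD_succ {G : Bilin n} {v : Model n →L[ℝ] ℝ}
    (hv : v (unitNormal G) = 0) (L : ℝ) (a b : Model n [⋀^Fin (p + 1)]→L[ℝ] ℂ) :
    symbolOnDecay L 1 (expNormalD G v (p + 1)) a b =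
      Complex.I • wedgeC v p (norC G p a) + tanC n (p + 1) b - (L : ℂ) • tanC n (p + 1) a := by
  rw [symbolOnDecay_expNormalD, conC_succ hv]
  module

theorem symbolOnDecay_expNormalLapD_succ {G : Bilin n} {v : Model n →L[ℝ] ℝ}
    (hv : v (unitNormal G) = 0) {L : ℝ} (hL : L ^ 2 = normSq G v)
    (a b : Model n [⋀^Fin (p + 1)]→L[ℝ] ℂ) :
    symbolOnDecay L 3 (expNormalLapD G v (p + 1)) a b =
      (2 * Complex.I * L) • wedgeC v p (norC G p b) - (2 * L ^ 2 : ℂ) • tanC n (p + 1) b := by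
  rw [symbolOnDecay_expNormalLapD G v hL, conC_succ hv]
  module

theorem isElliptic_normalLap (g : Metric n M) (l l' : ℝ) :
    BoundaryProblem.IsElliptic (p := p + 1)
      ⟨4, biLaplacian g, 4, ![opNormal g, opNormalD g, opNormalLap g l', opNormalLapD g l]⟩ g := by
  refine isElliptic_of_symbolData g (fun
    | 0 => symbolDataNormal g p
    | 1 => symbolDataNormalD g (p + 1)
    | 2 => symbolDataNormalLap g p l'
    | 3 => symbolDataNormalLapD g (p + 1) l) ?_ ?_
  · intro G v L symm pos hv hL hLv a b h
    exact injective_neumannSystem (Complex.ofReal_ne_zero.2 hL.ne')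
      (fun x => eq_zero_of_complexify_parts pos)
      ((symbolOnDecay_expNormal G L a b).symm.trans (h 0))
      ((symbolOnDecay_expNormalD_succ hv L a b).symm.trans (h 1))
      ((symbolOnDecay_expNormalLap G v hLv a b).symm.trans (h 2))
      ((symbolOnDecay_expNormalLapD_succ hv hLv a b).symm.trans (h 3))
  · intro G v L symm pos hv hL hLv z
    obtain ⟨a, b, h0, h1, h2, h3⟩ := surjective_neumannSystem (W := wedgeC v p)
      (Complex.ofReal_ne_zero.2 hL.ne') (exists_complexify_parts_eq pos) (z 0) (z 1) (z 2) (z 3)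
    exact ⟨a, b, fun
      | 0 => (symbolOnDecay_expNormal G L a b).trans h0
      | 1 => (symbolOnDecay_expNormalD_succ hv L a b).trans h1
      | 2 => (symbolOnDecay_expNormalLap G v hLv a b).trans h2
      | 3 => (symbolOnDecay_expNormalLapD_succ hv hLv a b).trans h3⟩

theorem isElliptic_codiff (g : Metric n M) (l : ℝ) :
    BoundaryProblem.IsElliptic (p := p + 1)
      ⟨4, biLaplacian g, 4, ![opNormal g, opNormalD g, opCodiff g, opNormalLapD g l]⟩ g := by
  have hJ : ∀ {G : Bilin n} {v : Model n →L[ℝ] ℝ} {L : ℝ} (h : sharp G v ∈ bdryTangent n),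
      L ^ 2 = normSq G v → ∀ y : bdryTangent n [⋀^Fin (p + 1)]→L[ℝ] ℂ,
      complexify (interiorMul (⟨sharp G v, h⟩ : bdryTangent n)) (wedgeC v p
        (complexify (interiorMul (⟨sharp G v, h⟩ : bdryTangent n)) y)) =
      (L : ℂ) ^ 2 • complexify (interiorMul (⟨sharp G v, h⟩ : bdryTangent n)) y := by
    intro G v L h hL y
    rw [wedgeC, ← complexify_comp, ← complexify_comp, ← Complex.ofReal_pow, ← complexify_smul, hL]
    congr 1
    congr 1
    exact LinearMap.ext fun u => interiorMul_wedge_interiorMul _ _ u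
  refine isElliptic_of_symbolData g (fun
    | 0 => symbolDataNormal g p
    | 1 => symbolDataNormalD g (p + 1)
    | 2 => symbolDataCodiff g p
    | 3 => symbolDataNormalLapD g (p + 1) l) ?_ ?_
  · intro G v L symm pos hv hL hLv a b h
    exact injective_codiffSystem (Complex.ofReal_ne_zero.2 hL.ne')
      (fun x => eq_zero_of_complexify_parts pos) (hJ (sharp_mem_bdryTangent symm pos hv) hLv)
      ((symbolOnDecay_expNormal G L a b).symm.trans (h 0))
      ((symbolOnDecay_expNormalD_succ hv L a b).symm.trans (h 1))
      ((symbolOnDecay_expCodiff symm pos hv L a b).symm.trans (h 2))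
      ((symbolOnDecay_expNormalLapD_succ hv hLv a b).symm.trans (h 3))
  · intro G v L symm pos hv hL hLv z
    obtain ⟨a, b, h0, h1, h2, h3⟩ := surjective_codiffSystem
      (Complex.ofReal_ne_zero.2 hL.ne') (exists_complexify_parts_eq pos)
      (hJ (sharp_mem_bdryTangent symm pos hv) hLv) (z 0) (z 1) (z 2) (z 3)
    exact ⟨a, b, fun
      | 0 => (symbolOnDecay_expNormal G L a b).trans h0
      | 1 => (symbolOnDecay_expNormalD_succ hv L a b).trans h1
      | 2 => (symbolOnDecay_expCodiff symm pos hv L a b).trans h2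
      | 3 => (symbolOnDecay_expNormalLapD_succ hv hLv a b).trans h3⟩

end Elliptic

end SteklovForms

end

theorem mainTheorem12 (n : ℕ) [NeZero n] (M : Type*) [TopologicalSpace M] [T2Space M]
    [CompactSpace M] [ChartedSpace (EuclideanHalfSpace n) M] [IsManifold (𝓡∂ n) ∞ M]
    (g : SteklovForms.Metric n M) (p : ℕ) (l : ℝ) :
    (SteklovForms.BSN1 g l p).IsElliptic g ∧
      (SteklovForms.BSN2 g l p).IsElliptic g ∧
      (SteklovForms.BSN3 g l p).IsElliptic g := by
  cases p with
  | zero =>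
    exact ⟨SteklovForms.isElliptic_functions g l, SteklovForms.isElliptic_functions g l,
      SteklovForms.isElliptic_functions g l⟩
  | succ p =>
    exact ⟨SteklovForms.isElliptic_normalLap g l l, SteklovForms.isElliptic_codiff g l,
      SteklovForms.isElliptic_normalLap g l 0⟩
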